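/- Let $k$ be a field. A finite abelian category is a $k$-linear category that is $k$-linearly equivalent to the category of finite-dimensional left modules over a finite-dimensional $k$-algebra. The Nakayama functor of a $k$-linear category $\mathcal M$ is an endofunctor $\mathbb N_{\mathcal M}$ together with universal dinatural transformations exhibiting it, functorially in $M$, as the coend $$\mathbb N_{\mathcal M}(M)=\int^{X\in\mathcal M}\operatorname{Hom}_{\mathcal M}(M,X)^*\odot X ,$$ where $V\odot X$ is the copower, $\operatorname{Hom}_{\mathcal M}(V\odot X,Z)\cong\operatorname{Hom}_k(V,\operatorname{Hom}_{\mathcal M}(X,Z))$. Let $\mathcal C$ be a finite multi-tensor category over $k$ (a finite abelian category with a rigid monoidal structure whose tensor product is bilinear), with duals $X^\vee$, $\mathrm{ev}_X:X^\vee\otimes X\to\mathbf 1$, $\mathrm{coev}_X:\mathbf 1\to X\otimes X^\vee$. Let $\mathcal M$ be a finite left $\mathcal C$-module category (a finite abelian category with a left $\mathcal C$-action $\rhd$ that is linear and right exact in each variable). Let $I\in\mathcal C$ be an invertible object, let $(A,m,u)$ be an algebra in $\mathcal C$, and let $\lambda:A\to I$ be an $I$-valued Frobenius trace, i.e. a morphism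 such that $$\phi=(\mathrm{ev}_I\otimes \mathrm{id}_{A^\vee})\circ(\mathrm{id}_{I^\vee}\otimes\lambda m\otimes \mathrm{id}_{A^\vee})\circ(\mathrm{id}_{I^\vee}\otimes\mathrm{id}_A\otimes\mathrm{coev}_A):I^\vee\otimes A\to A^\vee$$ is invertible. Let $\nu=(\phi^{-1}\otimes \mathrm{id}_{I^{\vee\vee}})\circ\phi^\vee:A^{\vee\vee}\to I^\vee\otimes A\otimes I^{\vee\vee}$ be the associated Nakayama isomorphism, and regard $A^{\vee\vee}$ as an algebra by $m^{\vee\vee}$ and $u^{\vee\vee}$. Write ${}_A\mathcal M$ for the category of left $A$-modules in $\mathcal M$ (pairs $(M,a)$ with $a:A\rhd M\to M$ associative and unital). Then the coend defining $\mathbb N_{\mathcal M}$ exists, and for every choice of $\mathbb N_{\mathcal M}$ the following hold. 1. For each $(M,a)\in{}_A\mathcal M$, the morphism $$\widetilde a=(\mathrm{id}_{I^\vee}\rhd a)\circ(\mathrm{id}_{I^\vee}\rhd\mathrm{id}_A\rhd\mathrm{ev}_{I^\vee}\rhd\mathrm{id}_M)\circ(\nu\rhd\mathrm{id}_{I^\vee\rhd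 M}):A^{\vee\vee}\rhd I^\vee\rhd M\to I^\vee\rhd M$$ makes $I^\vee\rhd M$ an $A^{\vee\vee}$-module. This gives a functor $I^\vee\rhd(-):{}_A\mathcal M\to{}_{A^{\vee\vee}}\mathcal M$. 2. For each $(M,b)\in{}_{A^{\vee\vee}}\mathcal M$, the composite $$A\rhd\mathbb N_{\mathcal M}(M)\xrightarrow{\ \mathfrak c\ }\mathbb N_{\mathcal M}(A^{\vee\vee}\rhd M)\xrightarrow{\ \mathbb N_{\mathcal M}(b)\ }\mathbb N_{\mathcal M}(M)$$ makes $\mathbb N_{\mathcal M}(M)$ an $A$-module. This lifts $\mathbb N_{\mathcal M}$ to a functor ${}_{A^{\vee\vee}}\mathcal M\to{}_A\mathcal M$. Here $\mathfrak c$ is the canonical morphism $G''\,\mathbb N_{\mathcal M}\to\mathbb N_{\mathcal M}\,G$ of $G=A^{\vee\vee}\rhd(-)$, with right adjoint $G'=A^\vee\rhd(-)$ and double right adjoint $G''=A\rhd(-)$. It is induced on coends by the morphisms $$\operatorname{Hom}(M,X)^*\odot G''X\to\operatorname{Hom}(M,G'G''X)^*\odot G''X\cong\operatorname{Hom}(GM,G''X)^*\odot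 G''X\to\mathbb N_{\mathcal M}(GM),$$ the first of which comes from the counit $G'G''X\to X$. 3. The composite functor $${}_A\mathcal M\xrightarrow{\ I^\vee\rhd(-)\ }{}_{A^{\vee\vee}}\mathcal M\xrightarrow{\ \text{lift of }\mathbb N_{\mathcal M}\ }{}_A\mathcal M$$ is the Nakayama functor of ${}_A\mathcal M$; that is, it carries a structure of the coend above for the category ${}_A\mathcal M$. -/

import Mathlib

open CategoryTheory MonoidalCategory MonoidalLeftAction Limits
open scoped MonObj

universe w v u v₁ u₁ v₂ u₂

noncomputable section

namespace FrobTrace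

/-! ### Finite abelian categories and their Nakayama functors -/

section Nakayama

/-- A `k`-linear category is a *finite abelian category* if it is equivalent, as a `k`-linear
category, to the category of finite-dimensional left modules over some finite-dimensional
`k`-algebra `R` (over such an `R`, finite-dimensional means finitely generated). -/
class IsFiniteAbelian (k : Type w) [Field k] (M : Type u) [Category.{v} M] [Preadditive M]
    [Linear k M] : Prop where
  exists_equivalence : ∃ (R : Type w) (_ : Ring R) (_ : Algebra k R) (_ : Module.Finite k R)
    (e : M ≌ FGModuleCat.{w} R), e.functor.Additive ∧ e.functor.Linear k

variable (k : Type w) [Field k] {M : Type u} [Category.{v} M] [Preadditive M] [Linear k M]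

/-- A dinatural transformation (cowedge) from the bifunctor
`(y, x) ↦ Hom(m, y)^* ⊙ x` on `Mᵒᵖ × M` to the object `z`.
The copower `V ⊙ x` of a vector space `V` and an object `x` is the object defined by
`Hom(V ⊙ x, z) ≅ Hom_k(V, Hom(x, z))`; hence the component `Hom(m, x)^* ⊙ x ⟶ z` is written as
a `k`-linear map `Hom(m, x)^* → Hom(x, z)`. -/
structure NakayamaCowedge (m z : M) where
  app (x : M) : Module.Dual k (m ⟶ x) →ₗ[k] (x ⟶ z)
  /-- Dinaturality: for `f : x ⟶ y`, the two morphisms `Hom(m, y)^* ⊙ x ⟶ z` agree. -/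
  dinatural {x y : M} (f : x ⟶ y) (ξ : Module.Dual k (m ⟶ y)) :
    app x (ξ ∘ₗ Linear.rightComp k m f) = f ≫ app y ξ

/-- The data exhibiting an endofunctor `N` as the Nakayama functor of `M`, that is, as the coend
`N(m) = ∫^{x ∈ M} Hom(m, x)^* ⊙ x`, functorially in `m`. -/
structure NakayamaStructure (N : M ⥤ M) where
  /-- The universal cowedge `Hom(m, x)^* ⊙ x ⟶ N(m)`. -/
  cowedge (m : M) : NakayamaCowedge k m (N.obj m)
  /-- The action of `N` on morphisms is the one induced by the functoriality of
  `Hom(m, x)^*` in `m`. -/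
  natural {m m' : M} (f : m ⟶ m') (x : M) (ξ : Module.Dual k (m ⟶ x)) :
    (cowedge m).app x ξ ≫ N.map f = (cowedge m').app x (ξ ∘ₗ Linear.leftComp k x f)
  desc {m z : M} (s : NakayamaCowedge k m z) : N.obj m ⟶ z
  fac {m z : M} (s : NakayamaCowedge k m z) (x : M) (ξ : Module.Dual k (m ⟶ x)) :
    (cowedge m).app x ξ ≫ desc s = s.app x ξ
  uniq {m z : M} (s : NakayamaCowedge k m z) (g : N.obj m ⟶ z)
    (hg : ∀ (x : M) (ξ : Module.Dual k (m ⟶ x)), (cowedge m).app x ξ ≫ g = s.app x ξ) :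
    g = desc s

variable {k} in
theorem NakayamaStructure.hom_ext {N : M ⥤ M} (hN : NakayamaStructure k N) {m z : M}
    {f g : N.obj m ⟶ z}
    (h : ∀ (x : M) (ξ : Module.Dual k (m ⟶ x)),
      (hN.cowedge m).app x ξ ≫ f = (hN.cowedge m).app x ξ ≫ g) : f = g := by
  let s : NakayamaCowedge k m z :=
    { app := fun x => Linear.rightComp k x g ∘ₗ (hN.cowedge m).app x
      dinatural := fun f ξ => by simp [(hN.cowedge m).dinatural] }
  rw [hN.uniq s f h, hN.uniq s g (fun _ _ => rfl)]

end Nakayama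

/-! ### The canonical morphism of a functor with a triple right adjoint -/

section Canonical

variable {k : Type w} [Field k]
  {M : Type u} [Category.{v} M] [Preadditive M] [Linear k M]
  {M' : Type u₁} [Category.{v₁} M'] [Preadditive M'] [Linear k M']
  {N : M ⥤ M} (hN : NakayamaStructure k N) {N' : M' ⥤ M'} (hN' : NakayamaStructure k N')
  {G : M ⥤ M'} {G₁ : M' ⥤ M} {G₂ : M ⥤ M'} {G₃ : M' ⥤ M}
  (adj₁ : G ⊣ G₁) (adj₂ : G₁ ⊣ G₂) (adj₃ : G₂ ⊣ G₃)

/-- The linear map `Hom(G(m), G₂(x)) ≅ Hom(m, G₁ G₂(x)) ⟶ Hom(m, x)` given by the adjunction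
`G ⊣ G₁` and the counit of `G₁ ⊣ G₂`. -/
def canonicalHom [G₁.Additive] [G₁.Linear k] (m x : M) :
    (G.obj m ⟶ G₂.obj x) →ₗ[k] (m ⟶ x) where
  toFun h := adj₁.unit.app m ≫ G₁.map h ≫ adj₂.counit.app x
  map_add' := by simp
  map_smul' := by simp

/-- The cowedge whose component `Hom(m, x)^* ⊙ x ⟶ G₃ N' G(m)` is the transpose, with respect
to `G₂ ⊣ G₃`, of
`Hom(m, x)^* ⊙ G₂(x) ⟶ Hom(m, G₁ G₂(x))^* ⊙ G₂(x) ≅ Hom(G(m), G₂(x))^* ⊙ G₂(x) ⟶ N' G(m)`. -/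
def canonicalCowedge [G₁.Additive] [G₁.Linear k] [G₃.Additive] [G₃.Linear k] (m : M) :
    NakayamaCowedge k m (G₃.obj (N'.obj (G.obj m))) where
  app x :=
    { toFun := fun ξ => adj₃.unit.app x ≫
        G₃.map ((hN'.cowedge (G.obj m)).app (G₂.obj x) (ξ ∘ₗ canonicalHom adj₁ adj₂ m x))
      map_add' := by simp [LinearMap.add_comp]
      map_smul' := by simp [LinearMap.smul_comp] }
  dinatural {x y} f ξ := by
    have h : (ξ ∘ₗ Linear.rightComp k m f) ∘ₗ canonicalHom (k := k) adj₁ adj₂ m x =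
        (ξ ∘ₗ canonicalHom (k := k) adj₁ adj₂ m y) ∘ₗ
          Linear.rightComp k (G.obj m) (G₂.map f) := by
      ext h
      simp [canonicalHom]
    simp only [LinearMap.coe_mk, AddHom.coe_mk]
    rw [h, (hN'.cowedge (G.obj m)).dinatural]
    simp

/-- The canonical morphism `G₂ N(m) ⟶ N' G(m)`, for a linear functor `G` with right adjoint
`G₁`, double right adjoint `G₂` and triple right adjoint `G₃`.  Since `G₂` is a left adjoint,
`G₂ N(m)` is the coend `∫^{x} Hom(m, x)^* ⊙ G₂(x)`, and the morphism is determined by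
`Hom(m, x)^* ⊙ G₂(x) ⟶ Hom(m, G₁ G₂(x))^* ⊙ G₂(x) ≅ Hom(G(m), G₂(x))^* ⊙ G₂(x) ⟶ N' G(m)`. -/
def canonical [G₁.Additive] [G₁.Linear k] [G₃.Additive] [G₃.Linear k] (m : M) :
    G₂.obj (N.obj m) ⟶ N'.obj (G.obj m) :=
  (adj₃.homEquiv _ _).symm (hN.desc (canonicalCowedge hN' adj₁ adj₂ adj₃ m))

theorem canonical_naturality [G₁.Additive] [G₁.Linear k] [G₃.Additive] [G₃.Linear k]
    {m m' : M} (f : m ⟶ m') :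
    G₂.map (N.map f) ≫ canonical hN hN' adj₁ adj₂ adj₃ m' =
      canonical hN hN' adj₁ adj₂ adj₃ m ≫ N'.map (G.map f) := by
  refine (adj₃.homEquiv _ _).injective ?_
  rw [adj₃.homEquiv_naturality_left, adj₃.homEquiv_naturality_right]
  simp only [canonical, Equiv.apply_symm_apply]
  refine (hN.hom_ext (fun x ξ => ?_))
  rw [← Category.assoc, hN.natural, hN.fac, ← Category.assoc, hN.fac]
  simp only [canonicalCowedge, LinearMap.coe_mk, AddHom.coe_mk, Category.assoc,
    ← Functor.map_comp, hN'.natural]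
  congr 4
  ext h
  simp [canonicalHom]

end Canonical

/-! ### Duals

For an object `X`, mathlib's `Xᘁ` comes with `ε_ X Xᘁ : Xᘁ ⊗ X ⟶ 𝟙` and `η_ X Xᘁ : 𝟙 ⟶ X ⊗ Xᘁ`.
This is the object denoted by `X^∨` (and called a left dual in the convention of Etingof, Gelaki,
Nikshych and Ostrik). -/

section Duals

variable {C : Type u₁} [Category.{v₁} C] [MonoidalCategory C]

theorem mate_eq {X Y : C} [hX : HasRightDual X] [hY : HasRightDual Y] {f : X ⟶ Y} {g : Yᘁ ⟶ Xᘁ}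
    (h : g ▷ X ≫ ε_ X (Xᘁ) = (Yᘁ) ◁ f ≫ ε_ Y (Yᘁ)) : fᘁ = g := by
  rw [← rightAdjointMate_comp_evaluation] at h
  have h' := congrArg (tensorRightHomEquiv _ X (Xᘁ) _) h
  rw [tensorRightHomEquiv_whiskerRight_comp_evaluation,
    tensorRightHomEquiv_whiskerRight_comp_evaluation] at h'
  exact ((cancel_mono _).1 h').symm

theorem mate_whiskerRight {X Y : C} (f : X ⟶ Y) (Z : C)
    [HasRightDual X] [HasRightDual Y] [HasRightDual Z] :
    @rightAdjointMate C _ _ (X ⊗ Z) (Y ⊗ Z) hasRightDualTensor hasRightDualTensor (f ▷ Z)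
      = (Zᘁ : C) ◁ fᘁ := by
  refine mate_eq (hX := hasRightDualTensor) (hY := hasRightDualTensor) ?_
  change (Zᘁ ◁ fᘁ) ▷ (X ⊗ Z) ≫ ε_ (X ⊗ Z) (Zᘁ ⊗ (Xᘁ : C)) =
    (Zᘁ ⊗ (Yᘁ : C)) ◁ (f ▷ Z) ≫ ε_ (Y ⊗ Z) (Zᘁ ⊗ (Yᘁ : C))
  rw [ExactPairing.tensor_evaluation, ExactPairing.tensor_evaluation]
  calc _ = 𝟙 _ ⊗≫ (Zᘁ : C) ◁ ((fᘁ ▷ X ≫ ε_ X (Xᘁ : C)) ▷ Z) ⊗≫ ε_ Z (Zᘁ : C) := by monoidal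
    _ = _ := by rw [rightAdjointMate_comp_evaluation]; monoidal

theorem mate_whiskerLeft (Z : C) {X Y : C} (f : X ⟶ Y)
    [HasRightDual X] [HasRightDual Y] [HasRightDual Z] :
    @rightAdjointMate C _ _ (Z ⊗ X) (Z ⊗ Y) hasRightDualTensor hasRightDualTensor (Z ◁ f)
      = fᘁ ▷ (Zᘁ : C) := by
  refine mate_eq (hX := hasRightDualTensor) (hY := hasRightDualTensor) ?_
  change (fᘁ ▷ (Zᘁ : C)) ▷ (Z ⊗ X) ≫ ε_ (Z ⊗ X) (Xᘁ ⊗ (Zᘁ : C)) =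
    (Yᘁ ⊗ (Zᘁ : C)) ◁ (Z ◁ f) ≫ ε_ (Z ⊗ Y) (Yᘁ ⊗ (Zᘁ : C))
  rw [ExactPairing.tensor_evaluation, ExactPairing.tensor_evaluation]
  calc _ = 𝟙 _ ⊗≫ (fᘁ ▷ (Zᘁ ⊗ Z) ≫ (Xᘁ : C) ◁ ε_ Z (Zᘁ : C)) ▷ X ⊗≫ ε_ X (Xᘁ : C) := by monoidal
    _ = 𝟙 _ ⊗≫ (Yᘁ : C) ◁ ε_ Z (Zᘁ : C) ▷ X ⊗≫ (fᘁ ▷ X ≫ ε_ X (Xᘁ : C)) := by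
        rw [← whisker_exchange]; monoidal
    _ = 𝟙 _ ⊗≫ (Yᘁ : C) ◁ (ε_ Z (Zᘁ : C) ▷ X ≫ 𝟙_ C ◁ f) ⊗≫ ε_ Y (Yᘁ : C) := by
        rw [rightAdjointMate_comp_evaluation]; monoidal
    _ = _ := by rw [← whisker_exchange]; monoidal

theorem mate_associator (X Y Z : C) [HasRightDual X] [HasRightDual Y] [HasRightDual Z] :
    @rightAdjointMate C _ _ ((X ⊗ Y) ⊗ Z) (X ⊗ Y ⊗ Z)
      (@hasRightDualTensor C _ _ (X ⊗ Y) Z hasRightDualTensor _)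
      (@hasRightDualTensor C _ _ X (Y ⊗ Z) _ hasRightDualTensor) (α_ X Y Z).hom
      = (α_ (Zᘁ : C) (Yᘁ : C) (Xᘁ : C)).hom := by
  refine mate_eq (hX := @hasRightDualTensor C _ _ (X ⊗ Y) Z hasRightDualTensor _)
    (hY := @hasRightDualTensor C _ _ X (Y ⊗ Z) _ hasRightDualTensor) ?_
  change (α_ (Zᘁ : C) (Yᘁ : C) (Xᘁ : C)).hom ▷ ((X ⊗ Y) ⊗ Z) ≫ ε_ ((X ⊗ Y) ⊗ Z) (Zᘁ ⊗ (Yᘁ ⊗ (Xᘁ : C))) =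
    ((Zᘁ ⊗ (Yᘁ : C)) ⊗ (Xᘁ : C)) ◁ (α_ X Y Z).hom ≫ ε_ (X ⊗ (Y ⊗ Z)) ((Zᘁ ⊗ (Yᘁ : C)) ⊗ (Xᘁ : C))
  simp only [ExactPairing.tensor_evaluation]
  monoidal

theorem mate_leftUnitor (X : C) [HasRightDual X] :
    @rightAdjointMate C _ _ (𝟙_ C ⊗ X) X
      (@hasRightDualTensor C _ _ (𝟙_ C) X hasRightDualUnit _) _ (λ_ X).hom
      = (ρ_ (Xᘁ : C)).inv := by
  refine mate_eq (hX := @hasRightDualTensor C _ _ (𝟙_ C) X hasRightDualUnit _) ?_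
  refine (congrArg ((ρ_ (Xᘁ : C)).inv ▷ (𝟙_ C ⊗ X) ≫ ·)
    (@ExactPairing.tensor_evaluation C _ _ (𝟙_ C) X (𝟙_ C) Xᘁ exactPairingUnit _)).trans ?_
  simp only [show ε_ (𝟙_ C) (𝟙_ C) = (ρ_ (𝟙_ C)).hom from rfl]
  monoidal

theorem mate_rightUnitor (X : C) [HasRightDual X] :
    @rightAdjointMate C _ _ (X ⊗ 𝟙_ C) X
      (@hasRightDualTensor C _ _ X (𝟙_ C) _ hasRightDualUnit) _ (ρ_ X).hom
      = (λ_ (Xᘁ : C)).inv := by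
  refine mate_eq (hX := @hasRightDualTensor C _ _ X (𝟙_ C) _ hasRightDualUnit) ?_
  refine (congrArg ((λ_ (Xᘁ : C)).inv ▷ (X ⊗ 𝟙_ C) ≫ ·)
    (@ExactPairing.tensor_evaluation C _ _ X (𝟙_ C) Xᘁ (𝟙_ C) _ exactPairingUnit)).trans ?_
  simp only [show ε_ (𝟙_ C) (𝟙_ C) = (ρ_ (𝟙_ C)).hom from rfl]
  monoidal

/-- The dual of an isomorphism. -/
def dualIso {X Y : C} [HasRightDual X] [HasRightDual Y] (e : X ≅ Y) : (Yᘁ : C) ≅ Xᘁ where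
  hom := e.homᘁ
  inv := e.invᘁ
  hom_inv_id := by rw [← comp_rightAdjointMate, e.inv_hom_id, rightAdjointMate_id]
  inv_hom_id := by rw [← comp_rightAdjointMate, e.hom_inv_id, rightAdjointMate_id]

/-- The dual `m^∨ : A^∨ ⟶ (A ⊗ A)^∨ = A^∨ ⊗ A^∨` of the multiplication of an algebra. -/
def dualComul (A : C) [MonObj A] [HasRightDual A] : (Aᘁ : C) ⟶ Aᘁ ⊗ Aᘁ :=
  @rightAdjointMate C _ _ (A ⊗ A) A hasRightDualTensor _ μ[A]

/-- The dual `u^∨ : A^∨ ⟶ 𝟙^∨ = 𝟙` of the unit of an algebra. -/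
def dualCounit (A : C) [MonObj A] [HasRightDual A] : (Aᘁ : C) ⟶ 𝟙_ C :=
  @rightAdjointMate C _ _ (𝟙_ C) A hasRightDualUnit _ η[A]

/-- The multiplication `m^∨∨ : A^∨∨ ⊗ A^∨∨ = (A ⊗ A)^∨∨ ⟶ A^∨∨`. -/
def doubleDualMul (A : C) [MonObj A] [HasRightDual A] [HasRightDual (Aᘁ : C)] :
    ((Aᘁ : C)ᘁ : C) ⊗ (Aᘁ : C)ᘁ ⟶ (Aᘁ : C)ᘁ :=
  @rightAdjointMate C _ _ (Aᘁ : C) (Aᘁ ⊗ Aᘁ) _ hasRightDualTensor (dualComul A)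

/-- The unit `u^∨∨ : 𝟙 = 𝟙^∨∨ ⟶ A^∨∨`. -/
def doubleDualOne (A : C) [MonObj A] [HasRightDual A] [HasRightDual (Aᘁ : C)] :
    𝟙_ C ⟶ ((Aᘁ : C)ᘁ : C) :=
  @rightAdjointMate C _ _ (Aᘁ : C) (𝟙_ C) _ hasRightDualUnit (dualCounit A)

theorem dualComul_counit_right (A : C) [MonObj A] [HasRightDual A] :
    dualComul A ≫ (Aᘁ : C) ◁ dualCounit A = (ρ_ (Aᘁ : C)).inv := by
  have h := congrArg (@rightAdjointMate C _ _ (𝟙_ C ⊗ A) A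
    (@hasRightDualTensor C _ _ (𝟙_ C) A hasRightDualUnit _) _) (MonObj.one_mul A)
  rw [mate_leftUnitor, @comp_rightAdjointMate C _ _ (𝟙_ C ⊗ A) (A ⊗ A) A
    (@hasRightDualTensor C _ _ (𝟙_ C) A hasRightDualUnit _) hasRightDualTensor _,
    @mate_whiskerRight C _ _ (𝟙_ C) A _ A hasRightDualUnit] at h
  exact h

theorem dualComul_counit_left (A : C) [MonObj A] [HasRightDual A] :
    dualComul A ≫ dualCounit A ▷ (Aᘁ : C) = (λ_ (Aᘁ : C)).inv := by
  have h := congrArg (@rightAdjointMate C _ _ (A ⊗ 𝟙_ C) A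
    (@hasRightDualTensor C _ _ A (𝟙_ C) _ hasRightDualUnit) _) (MonObj.mul_one A)
  rw [mate_rightUnitor, @comp_rightAdjointMate C _ _ (A ⊗ 𝟙_ C) (A ⊗ A) A
    (@hasRightDualTensor C _ _ A (𝟙_ C) _ hasRightDualUnit) hasRightDualTensor _,
    @mate_whiskerLeft C _ _ A (𝟙_ C) A _ hasRightDualUnit] at h
  exact h

theorem dualComul_coassoc (A : C) [MonObj A] [HasRightDual A] :
    dualComul A ≫ (Aᘁ : C) ◁ dualComul A =
      dualComul A ≫ dualComul A ▷ (Aᘁ : C) ≫ (α_ (Aᘁ : C) Aᘁ Aᘁ).hom := by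
  have h := congrArg (@rightAdjointMate C _ _ ((A ⊗ A) ⊗ A) A
    (@hasRightDualTensor C _ _ (A ⊗ A) A hasRightDualTensor _) _) (MonObj.mul_assoc A)
  rw [@comp_rightAdjointMate C _ _ ((A ⊗ A) ⊗ A) (A ⊗ A) A
      (@hasRightDualTensor C _ _ (A ⊗ A) A hasRightDualTensor _) hasRightDualTensor _,
    @comp_rightAdjointMate C _ _ ((A ⊗ A) ⊗ A) (A ⊗ (A ⊗ A)) A
      (@hasRightDualTensor C _ _ (A ⊗ A) A hasRightDualTensor _)
      (@hasRightDualTensor C _ _ A (A ⊗ A) _ hasRightDualTensor) _,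
    @comp_rightAdjointMate C _ _ (A ⊗ (A ⊗ A)) (A ⊗ A) A
      (@hasRightDualTensor C _ _ A (A ⊗ A) _ hasRightDualTensor) hasRightDualTensor _,
    @mate_whiskerRight C _ _ (A ⊗ A) A _ A hasRightDualTensor,
    @mate_whiskerLeft C _ _ A (A ⊗ A) A _ hasRightDualTensor, mate_associator] at h
  exact h.trans (Category.assoc _ _ _)

/-- The double dual `A^∨∨` of an algebra `A` is an algebra by `m^∨∨` and `u^∨∨`. -/
instance doubleDualMonObj (A : C) [MonObj A] [HasRightDual A] [HasRightDual (Aᘁ : C)] :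
    MonObj ((Aᘁ : C)ᘁ : C) where
  one := doubleDualOne A
  mul := doubleDualMul A
  one_mul := by
    have h := congrArg (@rightAdjointMate C _ _ (Aᘁ : C) Aᘁ _ _)
      ((dualComul_counit_right A =≫ (ρ_ (Aᘁ : C)).hom).trans (Iso.inv_hom_id _))
    rw [Category.assoc, rightAdjointMate_id,
      @comp_rightAdjointMate C _ _ (Aᘁ : C) (Aᘁ ⊗ Aᘁ) Aᘁ _ hasRightDualTensor _,
      @comp_rightAdjointMate C _ _ (Aᘁ ⊗ Aᘁ : C) (Aᘁ ⊗ 𝟙_ C) Aᘁ hasRightDualTensor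
        (@hasRightDualTensor C _ _ Aᘁ (𝟙_ C) _ hasRightDualUnit) _,
      mate_rightUnitor, @mate_whiskerLeft C _ _ (Aᘁ : C) Aᘁ (𝟙_ C) _ _ hasRightDualUnit] at h
    rw [← Iso.cancel_iso_inv_left (λ_ ((Aᘁ : C)ᘁ : C)), Iso.inv_hom_id]
    exact (Category.assoc _ _ _).symm.trans h
  mul_one := by
    have h := congrArg (@rightAdjointMate C _ _ (Aᘁ : C) Aᘁ _ _)
      ((dualComul_counit_left A =≫ (λ_ (Aᘁ : C)).hom).trans (Iso.inv_hom_id _))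
    rw [Category.assoc, rightAdjointMate_id,
      @comp_rightAdjointMate C _ _ (Aᘁ : C) (Aᘁ ⊗ Aᘁ) Aᘁ _ hasRightDualTensor _,
      @comp_rightAdjointMate C _ _ (Aᘁ ⊗ Aᘁ : C) (𝟙_ C ⊗ Aᘁ) Aᘁ hasRightDualTensor
        (@hasRightDualTensor C _ _ (𝟙_ C) Aᘁ hasRightDualUnit _) _,
      mate_leftUnitor, @mate_whiskerRight C _ _ (Aᘁ : C) (𝟙_ C) _ Aᘁ _ hasRightDualUnit] at h
    rw [← Iso.cancel_iso_inv_left (ρ_ ((Aᘁ : C)ᘁ : C)), Iso.inv_hom_id]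
    exact (Category.assoc _ _ _).symm.trans h
  mul_assoc := by
    have h := congrArg (@rightAdjointMate C _ _ (Aᘁ : C) ((Aᘁ : C) ⊗ (Aᘁ : C) ⊗ (Aᘁ : C)) _
      (@hasRightDualTensor C _ _ (Aᘁ : C) ((Aᘁ : C) ⊗ (Aᘁ : C)) _ hasRightDualTensor))
      (dualComul_coassoc A)
    rw [@comp_rightAdjointMate C _ _ (Aᘁ : C) (Aᘁ ⊗ Aᘁ) (Aᘁ ⊗ Aᘁ ⊗ Aᘁ) _ hasRightDualTensor
        (@hasRightDualTensor C _ _ (Aᘁ : C) (Aᘁ ⊗ Aᘁ) _ hasRightDualTensor),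
      @comp_rightAdjointMate C _ _ (Aᘁ : C) (Aᘁ ⊗ Aᘁ) (Aᘁ ⊗ Aᘁ ⊗ Aᘁ) _ hasRightDualTensor
        (@hasRightDualTensor C _ _ (Aᘁ : C) (Aᘁ ⊗ Aᘁ) _ hasRightDualTensor),
      @comp_rightAdjointMate C _ _ (Aᘁ ⊗ Aᘁ : C) ((Aᘁ ⊗ Aᘁ) ⊗ Aᘁ) (Aᘁ ⊗ Aᘁ ⊗ Aᘁ)
        hasRightDualTensor
        (@hasRightDualTensor C _ _ (Aᘁ ⊗ Aᘁ : C) Aᘁ hasRightDualTensor _)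
        (@hasRightDualTensor C _ _ (Aᘁ : C) (Aᘁ ⊗ Aᘁ) _ hasRightDualTensor),
      @mate_whiskerLeft C _ _ (Aᘁ : C) Aᘁ (Aᘁ ⊗ Aᘁ) _ _ hasRightDualTensor,
      @mate_whiskerRight C _ _ (Aᘁ : C) (Aᘁ ⊗ Aᘁ) _ Aᘁ _ hasRightDualTensor,
      mate_associator] at h
    exact h.trans (Category.assoc _ _ _)

theorem associator_inv_action {D : Type u₂} [Category.{v₂} D] [MonoidalLeftAction C D]
    (X Y Z : C) (d : D) :
    (α_ X Y Z).inv ⊵ₗ d =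
      (αₗ X (Y ⊗ Z) d).hom ≫ X ⊴ₗ (αₗ Y Z d).hom ≫ (αₗ X Y (Z ⊙ₗ d)).inv ≫
        (αₗ (X ⊗ Y) Z d).inv := by
  rw [← cancel_epi ((α_ X Y Z).hom ⊵ₗ d), hom_inv_actionHomLeft,
    associator_actionHom_assoc]
  simp

/-- For a dual pair with `η_ X Y : 𝟙 ⟶ X ⊗ Y` and `ε_ X Y : Y ⊗ X ⟶ 𝟙`, the functor `Y ⊙ₗ -` is
left adjoint to `X ⊙ₗ -`, by the unit `η_ X Y ⊵ₗ d` and the counit `ε_ X Y ⊵ₗ d`. -/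
def actionAdj (D : Type u₂) [Category.{v₂} D] [MonoidalLeftAction C D] (X Y : C)
    [ExactPairing X Y] :
    actionLeft D Y ⊣ actionLeft D X :=
  Adjunction.mkOfUnitCounit
    { unit :=
        { app := fun d => (λₗ d).inv ≫ η_ X Y ⊵ₗ d ≫ (αₗ X Y d).hom
          naturality := fun d d' f => by
            have h := action_exchange (η_ X Y) f
            rw [unit_actionHomRight, tensor_actionHomRight, Category.assoc, Category.assoc,
              ← Iso.eq_inv_comp] at h
            change f ≫ (λₗ d').inv ≫ η_ X Y ⊵ₗ d' ≫ (αₗ X Y d').hom =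
              ((λₗ d).inv ≫ η_ X Y ⊵ₗ d ≫ (αₗ X Y d).hom) ≫ X ⊴ₗ Y ⊴ₗ f
            rw [reassoc_of% h]
            simp }
      counit :=
        { app := fun d => (αₗ Y X d).inv ≫ ε_ X Y ⊵ₗ d ≫ (λₗ d).hom
          naturality := fun d d' f => by
            have h := action_exchange (ε_ X Y) f
            rw [unit_actionHomRight, tensor_actionHomRight, Category.assoc, Category.assoc,
              ← Iso.eq_inv_comp] at h
            change Y ⊴ₗ X ⊴ₗ f ≫ (αₗ Y X d').inv ≫ ε_ X Y ⊵ₗ d' ≫ (λₗ d').hom =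
              ((αₗ Y X d).inv ≫ ε_ X Y ⊵ₗ d ≫ (λₗ d).hom) ≫ f
            rw [reassoc_of% h]
            simp }
      left_triangle := by
        ext d
        have h := congrArg (· ⊵ₗ d) (ExactPairing.coevaluation_evaluation X Y)
        change Y ⊴ₗ ((λₗ d).inv ≫ η_ X Y ⊵ₗ d ≫ (αₗ X Y d).hom) ≫ (𝟙 _) ≫
            (αₗ Y X (Y ⊙ₗ d)).inv ≫ ε_ X Y ⊵ₗ (Y ⊙ₗ d) ≫ (λₗ (Y ⊙ₗ d)).hom = 𝟙 _
        simp only [comp_actionHomLeft, whiskerLeft_actionHomLeft, rightUnitor_actionHom,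
          associator_inv_action, Category.assoc, Iso.inv_hom_id_assoc] at h
        have h' : (λ_ Y).inv ⊵ₗ d ≫ (αₗ (𝟙_ C) Y d).hom ≫ (λₗ (Y ⊙ₗ d)).hom = 𝟙 _ := by
          rw [← leftUnitor_actionHom, inv_hom_actionHomLeft]
        rw [Iso.cancel_iso_hom_left] at h
        rw [actionHomLeft_action, actionHomRight_comp, actionHomRight_comp]
        simp only [Category.assoc, Category.id_comp]
        rw [reassoc_of% h, h', Category.comp_id, actionHomRight_inv_hom]
      right_triangle := by
        ext d
        have h := congrArg (· ⊵ₗ d) (ExactPairing.evaluation_coevaluation X Y)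
        change ((λₗ (X ⊙ₗ d)).inv ≫ η_ X Y ⊵ₗ (X ⊙ₗ d) ≫ (αₗ X Y (X ⊙ₗ d)).hom) ≫ (𝟙 _) ≫
            X ⊴ₗ ((αₗ Y X d).inv ≫ ε_ X Y ⊵ₗ d ≫ (λₗ d).hom) = 𝟙 _
        simp only [comp_actionHomLeft, whiskerLeft_actionHomLeft, leftUnitor_actionHom,
          Category.assoc] at h
        have h'' : (α_ X Y X).hom ⊵ₗ d ≫ (αₗ X (Y ⊗ X) d).hom =
            (αₗ (X ⊗ Y) X d).hom ≫ (αₗ X Y (X ⊙ₗ d)).hom ≫ X ⊴ₗ (αₗ Y X d).inv := by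
          simp [← associator_actionHom_assoc]
        rw [reassoc_of% h''] at h
        simp only [actionHomLeft_action, actionHomRight_comp, Category.assoc, Category.id_comp]
        have h3 := h =≫ ((αₗ X (𝟙_ C) d).hom ≫ X ⊴ₗ (λₗ d).hom)
        simp only [Category.assoc, Iso.inv_hom_id_assoc] at h3
        rw [h3, ← rightUnitor_actionHom, inv_hom_actionHomLeft]
        simp }

end Duals

/-! ### Finite multi-tensor categories and finite module categories -/

section ModuleCategories

/-- A *finite multi-tensor category* is a finite abelian category with a structure of a rigid
monoidal category whose monoidal product is bilinear. -/
class IsFiniteMultiTensor (k : Type w) [Field k] (C : Type u₁) [Category.{v₁} C] [Preadditive C]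
    [Linear k C] [MonoidalCategory C] [RigidCategory C] : Prop
    extends IsFiniteAbelian k C, MonoidalPreadditive C, MonoidalLinear k C

/-- The action `C × D ⥤ D` is additive in each variable. -/
class ActionPreadditive (C : Type u₁) [Category.{v₁} C] [Preadditive C] [MonoidalCategory C]
    (D : Type u₂) [Category.{v₂} D] [Preadditive D] [MonoidalLeftAction C D] : Prop where
  action_add (c : C) {d d' : D} (f g : d ⟶ d') : c ⊴ₗ (f + g) = c ⊴ₗ f + c ⊴ₗ g
  add_action {c c' : C} (f g : c ⟶ c') (d : D) : (f + g) ⊵ₗ d = f ⊵ₗ d + g ⊵ₗ d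

/-- The action `C × D ⥤ D` is compatible with scalars in each variable. -/
class ActionLinear (k : Type w) [Field k] (C : Type u₁) [Category.{v₁} C] [Preadditive C]
    [Linear k C] [MonoidalCategory C] (D : Type u₂) [Category.{v₂} D] [Preadditive D] [Linear k D]
    [MonoidalLeftAction C D] : Prop where
  action_smul (c : C) {d d' : D} (r : k) (f : d ⟶ d') : c ⊴ₗ (r • f) = r • c ⊴ₗ f
  smul_action {c c' : C} (r : k) (f : c ⟶ c') (d : D) : (r • f) ⊵ₗ d = r • f ⊵ₗ d

/-- A *finite left `C`-module category* is a finite abelian category `D` with a left action of the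
monoidal category `C` that is linear and right exact in each variable. -/
class IsFiniteModuleCategory (k : Type w) [Field k] (C : Type u₁) [Category.{v₁} C]
    [Preadditive C] [Linear k C] [MonoidalCategory C] (D : Type u₂) [Category.{v₂} D]
    [Preadditive D] [Linear k D] [MonoidalLeftAction C D] : Prop
    extends IsFiniteAbelian k D, ActionPreadditive C D, ActionLinear k C D where
  rightExact_left (c : C) : PreservesFiniteColimits (actionLeft D c)
  rightExact_right (d : D) : PreservesFiniteColimits (actionRight C d)

variable {C : Type u₁} [Category.{v₁} C] [Preadditive C] [MonoidalCategory C]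
  {D : Type u₂} [Category.{v₂} D] [Preadditive D] [MonoidalLeftAction C D]

instance actionLeft_additive [ActionPreadditive C D] (c : C) : (actionLeft D c).Additive where
  map_add {_ _ f g} := ActionPreadditive.action_add c f g

instance actionLeft_linear (k : Type w) [Field k] [Linear k C] [Linear k D] [ActionLinear k C D]
    (c : C) : (actionLeft D c).Linear k where
  map_smul f r := ActionLinear.action_smul c r f

variable [ActionPreadditive C D] {A : C} [MonObj A]

/-- The additive group of morphisms of `A`-modules, as a subgroup of the morphisms in `D`. -/
def modHomSubgroup (P Q : Mod D A) : AddSubgroup (P.X ⟶ Q.X) where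
  carrier := {f | ModObj.smul (M := A) (X := P.X) ≫ f = A ⊴ₗ f ≫ ModObj.smul (M := A) (X := Q.X)}
  add_mem' {f g} hf hg := by
    simp only [Set.mem_ofPred_eq] at hf hg ⊢
    rw [Preadditive.comp_add, hf, hg, ActionPreadditive.action_add, Preadditive.add_comp]
  zero_mem' := by
    have h : A ⊴ₗ (0 : P.X ⟶ Q.X) = 0 := (actionLeft D A).map_zero P.X Q.X
    simp [h]
  neg_mem' {f} hf := by
    have h : A ⊴ₗ (-f) = -(A ⊴ₗ f) := (actionLeft D A).map_neg
    simp only [Set.mem_ofPred_eq] at hf ⊢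
    rw [Preadditive.comp_neg, hf, h, Preadditive.neg_comp]

/-- Morphisms of `A`-modules as elements of `modHomSubgroup`. -/
def modHomEquiv (P Q : Mod D A) : (P ⟶ Q) ≃ modHomSubgroup P Q where
  toFun f := ⟨f.hom, IsModHom.smul_hom⟩
  invFun f := Mod.Hom.mk' f.1 f.2

/-- `A`-modules form a preadditive category, with the addition of the underlying morphisms. -/
instance modPreadditive : Preadditive (Mod D A) where
  homGroup P Q := (modHomEquiv P Q).addCommGroup
  add_comp _ _ _ f f' g := Mod.hom_ext _ _ (Preadditive.add_comp _ _ _ f.hom f'.hom g.hom)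
  comp_add _ _ _ f g g' := Mod.hom_ext _ _ (Preadditive.comp_add _ _ _ f.hom g.hom g'.hom)

variable (k : Type w) [Field k] [Linear k C] [Linear k D] [ActionLinear k C D]

/-- The scalar multiplication on morphisms of `A`-modules. -/
abbrev modHomSMul (P Q : Mod D A) : SMul k (P ⟶ Q) where
  smul r f := Mod.Hom.mk' (r • f.hom) (by
    rw [Linear.comp_smul, IsModHom.smul_hom, ActionLinear.action_smul, Linear.smul_comp])

/-- `A`-modules form a `k`-linear category, with the scalar action on the underlying morphisms. -/
instance modLinear : Linear k (Mod D A) where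
  homModule P Q := letI := modHomSMul k P Q; Function.Injective.module k
    { toFun := fun f : P ⟶ Q => f.hom
      map_zero' := rfl
      map_add' := fun _ _ => rfl : (P ⟶ Q) →+ (P.X ⟶ Q.X) }
    (fun _ _ h => Mod.hom_ext _ _ h) (fun _ _ => rfl)
  smul_comp _ _ _ r f g := Mod.hom_ext _ _ (Linear.smul_comp _ _ _ r f.hom g.hom)
  comp_smul _ _ _ f r g := Mod.hom_ext _ _ (Linear.comp_smul _ _ _ f.hom r g.hom)

end ModuleCategories

/-! ### Algebras with a Frobenius trace -/

section Frobenius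

variable {C : Type u₁} [Category.{v₁} C] [MonoidalCategory C] [RigidCategory C]

/-- An object of a rigid monoidal category is invertible if its evaluation and its coevaluation
are isomorphisms. -/
def IsInvertibleObject (I : C) : Prop :=
  IsIso (ε_ I (Iᘁ : C)) ∧ IsIso (η_ I (Iᘁ : C))

variable {A I : C} [MonObj A]

/-- The morphism
`φ = (ev_I ⊗ A^∨) ∘ (I^∨ ⊗ λ m ⊗ A^∨) ∘ (I^∨ ⊗ A ⊗ coev_A) : I^∨ ⊗ A ⟶ A^∨` attached to a
morphism `λ : A ⟶ I`. -/
def frobeniusPhi (lam : A ⟶ I) : (Iᘁ : C) ⊗ A ⟶ (Aᘁ : C) :=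
  (ρ_ _).inv ≫ ((Iᘁ : C) ⊗ A) ◁ η_ A (Aᘁ : C) ⊗≫
    (Iᘁ : C) ◁ (μ[A] ≫ lam) ▷ (Aᘁ : C) ⊗≫ ε_ I (Iᘁ : C) ▷ (Aᘁ : C) ≫ (λ_ _).hom

/-- `lam : A ⟶ I` is an `I`-valued Frobenius trace on the algebra `A`. -/
def IsFrobeniusTrace (lam : A ⟶ I) : Prop := IsIso (frobeniusPhi lam)

/-- The isomorphism `φ : I^∨ ⊗ A ≅ A^∨` of a Frobenius trace. -/
def frobeniusIso {lam : A ⟶ I} (h : IsFrobeniusTrace lam) : (Iᘁ : C) ⊗ A ≅ (Aᘁ : C) :=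
  @asIso _ _ _ _ (frobeniusPhi lam) h

/-- The Nakayama isomorphism
`ν = (φ⁻¹ ⊗ I^∨∨) ∘ φ^∨ : A^∨∨ ⟶ (I^∨ ⊗ A)^∨ = A^∨ ⊗ I^∨∨ ⟶ I^∨ ⊗ A ⊗ I^∨∨`. -/
def nakayamaIso {lam : A ⟶ I} (h : IsFrobeniusTrace lam) :
    ((Aᘁ : C)ᘁ : C) ≅ ((Iᘁ : C) ⊗ A) ⊗ ((Iᘁ : C)ᘁ : C) :=
  @dualIso C _ _ ((Iᘁ : C) ⊗ A) (Aᘁ : C) hasRightDualTensor _ (frobeniusIso h) ≪≫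
    whiskerRightIso (frobeniusIso h).symm ((Iᘁ : C)ᘁ : C)

end Frobenius

/-! ### The two functors -/

section Functors

/-- The unit and the associative law for a morphism `a : A ⊙ₗ X ⟶ X` to be an action of the
algebra `A` on `X`. -/
structure IsModuleAction {C : Type u₁} [Category.{v₁} C] [MonoidalCategory C]
    {D : Type u₂} [Category.{v₂} D] [MonoidalLeftAction C D] (A : C) [MonObj A] {X : D}
    (a : A ⊙ₗ X ⟶ X) : Prop where
  one_smul : η[A] ⊵ₗ X ≫ a = (λₗ X).hom
  mul_smul : μ[A] ⊵ₗ X ≫ a = (αₗ A A X).hom ≫ A ⊴ₗ a ≫ a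

/-- The `A`-module with a given underlying object and action. -/
abbrev modOfAction {C : Type u₁} [Category.{v₁} C] [MonoidalCategory C]
    {D : Type u₂} [Category.{v₂} D] [MonoidalLeftAction C D] (A : C) [MonObj A] {X : D}
    (a : A ⊙ₗ X ⟶ X) (h : IsModuleAction A a) : Mod D A :=
  letI : ModObj A X := { smul := a, one_smul := h.one_smul, mul_smul := h.mul_smul }
  ⟨X⟩

variable {C : Type u₁} [Category.{v₁} C] [MonoidalCategory C] [RigidCategory C]
  {M : Type u₂} [Category.{v₂} M] [MonoidalLeftAction C M]
  {A I : C} [MonObj A]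

/-- The twisted action
`A^∨∨ ⊙ I^∨ ⊙ X ⟶ I^∨ ⊙ A ⊙ I^∨∨ ⊙ I^∨ ⊙ X ⟶ I^∨ ⊙ A ⊙ X ⟶ I^∨ ⊙ X` of `A^∨∨` on `I^∨ ⊙ X`, for
an `A`-module `X` in `M`, given by the Nakayama isomorphism, the evaluation of `I^∨` and the
action of `A` on `X`. -/
def twistedAction {lam : A ⟶ I} (hlam : IsFrobeniusTrace lam) (X : Mod M A) :
    ((Aᘁ : C)ᘁ : C) ⊙ₗ (Iᘁ : C) ⊙ₗ X.X ⟶ (Iᘁ : C) ⊙ₗ X.X :=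
  (nakayamaIso hlam).hom ⊵ₗ ((Iᘁ : C) ⊙ₗ X.X) ≫
    (αₗ ((Iᘁ : C) ⊗ A) ((Iᘁ : C)ᘁ : C) ((Iᘁ : C) ⊙ₗ X.X)).hom ≫
    ((Iᘁ : C) ⊗ A) ⊴ₗ ((αₗ ((Iᘁ : C)ᘁ : C) (Iᘁ : C) X.X).inv ≫
      ε_ (Iᘁ : C) ((Iᘁ : C)ᘁ : C) ⊵ₗ X.X ≫ (λₗ X.X).hom) ≫
    (αₗ (Iᘁ : C) A X.X).hom ≫ (Iᘁ : C) ⊴ₗ ModObj.smul (M := A) (X := X.X)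

theorem twistedAction_naturality {lam : A ⟶ I} (hlam : IsFrobeniusTrace lam) {X Y : Mod M A}
    (f : X ⟶ Y) :
    twistedAction hlam X ≫ (Iᘁ : C) ⊴ₗ f.hom =
      ((Aᘁ : C)ᘁ : C) ⊴ₗ (Iᘁ : C) ⊴ₗ f.hom ≫ twistedAction hlam Y := by
  have h₁ : ((Iᘁ : C)ᘁ : C) ⊴ₗ (Iᘁ : C) ⊴ₗ f.hom ≫ (αₗ ((Iᘁ : C)ᘁ : C) (Iᘁ : C) Y.X).inv ≫
      ε_ (Iᘁ : C) ((Iᘁ : C)ᘁ : C) ⊵ₗ Y.X ≫ (λₗ Y.X).hom =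
      ((αₗ ((Iᘁ : C)ᘁ : C) (Iᘁ : C) X.X).inv ≫
        ε_ (Iᘁ : C) ((Iᘁ : C)ᘁ : C) ⊵ₗ X.X ≫ (λₗ X.X).hom) ≫ f.hom :=
    (actionAdj M (Iᘁ : C) ((Iᘁ : C)ᘁ : C)).counit.naturality f.hom
  have h₂ : ModObj.smul (M := A) (X := X.X) ≫ f.hom =
      A ⊴ₗ f.hom ≫ ModObj.smul (M := A) (X := Y.X) := IsModHom.smul_hom
  have h₃ : (αₗ (Iᘁ : C) A X.X).hom ≫ (Iᘁ : C) ⊴ₗ A ⊴ₗ f.hom =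
      ((Iᘁ : C) ⊗ A) ⊴ₗ f.hom ≫ (αₗ (Iᘁ : C) A Y.X).hom := by
    simp
  have h₄ : (αₗ ((Iᘁ : C) ⊗ A) ((Iᘁ : C)ᘁ : C) ((Iᘁ : C) ⊙ₗ X.X)).hom ≫
        ((Iᘁ : C) ⊗ A) ⊴ₗ ((Iᘁ : C)ᘁ : C) ⊴ₗ (Iᘁ : C) ⊴ₗ f.hom =
      (((Iᘁ : C) ⊗ A) ⊗ ((Iᘁ : C)ᘁ : C)) ⊴ₗ (Iᘁ : C) ⊴ₗ f.hom ≫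
        (αₗ ((Iᘁ : C) ⊗ A) ((Iᘁ : C)ᘁ : C) ((Iᘁ : C) ⊙ₗ Y.X)).hom := by
    rw [tensor_actionHomRight ((Iᘁ : C) ⊗ A)]
    simp only [Category.assoc, Iso.inv_hom_id, Category.comp_id]
  unfold twistedAction
  revert h₁
  generalize (αₗ ((Iᘁ : C)ᘁ : C) (Iᘁ : C) X.X).inv ≫
    ε_ (Iᘁ : C) ((Iᘁ : C)ᘁ : C) ⊵ₗ X.X ≫ (λₗ X.X).hom = eX
  generalize (αₗ ((Iᘁ : C)ᘁ : C) (Iᘁ : C) Y.X).inv ≫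
    ε_ (Iᘁ : C) ((Iᘁ : C)ᘁ : C) ⊵ₗ Y.X ≫ (λₗ Y.X).hom = eY
  intro h₁
  rw [Category.assoc, Category.assoc, Category.assoc, Category.assoc, ← actionHomRight_comp, h₂,
    actionHomRight_comp, reassoc_of% h₃, ← actionHomRight_comp_assoc, ← h₁,
    actionHomRight_comp_assoc, reassoc_of% h₄, action_exchange_assoc]

/-- The functor `X ↦ I^∨ ⊙ X` from `A`-modules to `A^∨∨`-modules, with the twisted action. -/
def twistFunctor {lam : A ⟶ I} (hlam : IsFrobeniusTrace lam)
    (h : ∀ X : Mod M A, IsModuleAction ((Aᘁ : C)ᘁ : C) (twistedAction hlam X)) :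
    Mod M A ⥤ Mod M ((Aᘁ : C)ᘁ : C) where
  obj X := modOfAction ((Aᘁ : C)ᘁ : C) (twistedAction hlam X) (h X)
  map f := Mod.Hom.mk' ((Iᘁ : C) ⊴ₗ f.hom) (twistedAction_naturality hlam f)
  map_id _ := Mod.hom_ext _ _ (actionHomRight_id _ _)
  map_comp _ _ := Mod.hom_ext _ _ (actionHomRight_comp _ _ _)

variable [Preadditive C] [Preadditive M] [ActionPreadditive C M]
  {k : Type w} [Field k] [Linear k C] [Linear k M] [ActionLinear k C M]
  {N : M ⥤ M}

/-- The canonical morphism `A ⊙ N(m) ⟶ N(A^∨∨ ⊙ m)`, that is, the canonical morphism of the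
functor `A^∨∨ ⊙ -` with its right adjoint `A^∨ ⊙ -`, double right adjoint `A ⊙ -` and triple right
adjoint `^∨A ⊙ -`. -/
def canonicalAction (hN : NakayamaStructure k N) (A : C) (m : M) :
    A ⊙ₗ N.obj m ⟶ N.obj (((Aᘁ : C)ᘁ : C) ⊙ₗ m) :=
  canonical hN hN (actionAdj M (Aᘁ : C) ((Aᘁ : C)ᘁ : C)) (actionAdj M A (Aᘁ : C))
    (actionAdj M (ᘁA : C) A) m

/-- The action `A ⊙ N(X) ⟶ N(A^∨∨ ⊙ X) ⟶ N(X)` of `A` on `N(X)`, for an `A^∨∨`-module `X`. -/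
def liftedAction (hN : NakayamaStructure k N) (X : Mod M ((Aᘁ : C)ᘁ : C)) :
    A ⊙ₗ N.obj X.X ⟶ N.obj X.X :=
  canonicalAction hN A X.X ≫ N.map (ModObj.smul (M := ((Aᘁ : C)ᘁ : C)) (X := X.X))

theorem liftedAction_naturality (hN : NakayamaStructure k N) {X Y : Mod M ((Aᘁ : C)ᘁ : C)}
    (f : X ⟶ Y) :
    liftedAction hN X ≫ N.map f.hom = A ⊴ₗ N.map f.hom ≫ liftedAction hN Y := by
  have h₁ : A ⊴ₗ N.map f.hom ≫ canonicalAction hN A Y.X =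
      canonicalAction hN A X.X ≫ N.map (((Aᘁ : C)ᘁ : C) ⊴ₗ f.hom) :=
    canonical_naturality hN hN (actionAdj M (Aᘁ : C) ((Aᘁ : C)ᘁ : C)) (actionAdj M A (Aᘁ : C))
      (actionAdj M (ᘁA : C) A) f.hom
  have h₂ : ModObj.smul (M := ((Aᘁ : C)ᘁ : C)) (X := X.X) ≫ f.hom =
      ((Aᘁ : C)ᘁ : C) ⊴ₗ f.hom ≫ ModObj.smul (M := ((Aᘁ : C)ᘁ : C)) (X := Y.X) :=
    IsModHom.smul_hom
  unfold liftedAction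
  rw [reassoc_of% h₁, Category.assoc, ← N.map_comp, h₂, N.map_comp]

/-- The lift of the Nakayama functor `N` of `M` to a functor from `A^∨∨`-modules to
`A`-modules. -/
def liftFunctor (hN : NakayamaStructure k N)
    (h : ∀ X : Mod M ((Aᘁ : C)ᘁ : C), IsModuleAction A (liftedAction hN X)) :
    Mod M ((Aᘁ : C)ᘁ : C) ⥤ Mod M A where
  obj X := modOfAction A (liftedAction hN X) (h X)
  map f := Mod.Hom.mk' (N.map f.hom) (liftedAction_naturality hN f)
  map_id _ := Mod.hom_ext _ _ (N.map_id _)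
  map_comp _ _ := Mod.hom_ext _ _ (N.map_comp _ _)

end Functors

end FrobTrace

end

open FrobTrace

/-! Write `T = A ⊙ -`, `K = A^∨ ⊙ -`, `L = A^∨∨ ⊙ -` and `J = I^∨ ⊙ -`, so that `L ⊣ K ⊣ T`, and `T`
has a further right adjoint. The Frobenius trace gives `φ : J T ≅ K` and a form `σ : J T ⟶ 𝟭`, and
`φ` carries the pairing `K T ⟶ 𝟭` to the form `σ` after multiplication. Everything else is formal
and is done for a monad `T` with such data.

As for ordinary Frobenius algebras, nondegeneracy yields a Casimir copairing `d ⟶ T J T d`, which is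
central (`casimir_mul`). It defines the Higman trace `Hom(J X, Y) ⟶ Hom_T(X, Y)` for `T`-algebras
`X`, `Y`, while `σ` defines a form map `Hom_T(X, T y) ⟶ Hom(J X, y)`. Form after trace into a free
module, with the unit inserted, is the identity (`formMap_higmanTrace_unit`), and trace after form
is composition with the action (`higmanTrace_formMap`). Hence the free module functor is right
adjoint to `X ↦ J X`.

An `L`-action on `W` amounts, by adjunction, to maps `Hom(W, T y) ⟶ Hom(W, y)` compatible with the
unit and multiplication of `T`. For the twisted action on `J X` these maps are form after trace
(`mateMap_monadTwist`), so statement 1 follows from the two identities above. On the universal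
cowedge, the action of `A` on `N(W)` is precomposition of linear forms with these same maps
(`map_cowedge_canonical`), which gives statement 2.

For statement 3, a linear form on `Hom_A(X, Y)` composed with the Higman trace is a linear form on
`Hom(J X, Y)`, to which the cowedge of `N(J X)` applies. Conversely a cowedge on `A`-modules is
determined by its values on free modules, where the form map turns it into a cowedge on the base
category; the two constructions match by the same two identities. Existence reduces to modules over
an algebra `R`, where `Hom(m, R)^*` is the coend. -/

noncomputable section

namespace FrobTrace

/-! ### Frobenius traces on monads -/

section MonadTrace

variable {D : Type u} [Category.{v} D] {T : Monad D} {K J : D ⥤ D}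

/-- The two identities satisfied by an action of a monad on an object. -/
structure IsMonadAction (T : Monad D) {X : D} (a : T.obj X ⟶ X) : Prop where
  unit : T.η.app X ≫ a = 𝟙 X
  assoc : T.μ.app X ≫ a = T.map a ≫ a

theorem isMonadAction_free (T : Monad D) (y : D) : IsMonadAction T (T.μ.app y) :=
  ⟨T.left_unit y, (T.assoc y).symm⟩

section Frobenius

variable (adj : K ⊣ T.toFunctor) (φ : T.toFunctor ⋙ J ≅ K) (σ : T.toFunctor ⋙ J ⟶ 𝟭 D)

/-- The copairing `d ⟶ T J T d` obtained from the unit of `K ⊣ T` and `K ≅ J T`. -/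
def casimir (d : D) : d ⟶ T.obj (J.obj (T.obj d)) :=
  adj.unit.app d ≫ T.map (φ.inv.app d)

theorem casimir_naturality {d d' : D} (f : d ⟶ d') :
    f ≫ casimir adj φ d' = casimir adj φ d ≫ T.map (J.map (T.map f)) := by
  have h := φ.inv.naturality f
  have h' := adj.unit.naturality f
  simp only [Functor.id_obj, Functor.comp_obj, Functor.id_map, Functor.comp_map] at h h'
  simp only [casimir, Category.assoc, ← Functor.map_comp, ← h]
  rw [reassoc_of% h', T.map_comp]

/-- The map `Hom(X, T y) ⟶ Hom(J X, y)` given by a transformation `J T ⟶ 𝟭`. -/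
def formMap {X y : D} (g : X ⟶ T.obj y) : J.obj X ⟶ y := J.map g ≫ σ.app y

theorem formMap_comp_map {X y z : D} (g : X ⟶ T.obj y) (h : y ⟶ z) :
    formMap σ (g ≫ T.map h) = formMap σ g ≫ h := by
  have := σ.naturality h
  simp only [Functor.comp_map, Functor.id_map] at this
  simp [formMap, this]

theorem formMap_add [Preadditive D] [J.Additive] {X y : D} (g g' : X ⟶ T.obj y) :
    formMap σ (g + g') = formMap σ g + formMap σ g' := by
  simp [formMap]

theorem formMap_smul {k : Type w} [Field k] [Preadditive D] [Linear k D] [J.Additive]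
    [J.Linear k] {X y : D} (r : k) (g : X ⟶ T.obj y) :
    formMap σ (r • g) = r • formMap σ g := by
  simp [formMap]

/-- The Higman trace `Hom(J X, Y) ⟶ Hom(X, Y)` for two `T`-algebras `X` and `Y`. -/
def higmanTrace {X Y : D} (a : T.obj X ⟶ X) (b : T.obj Y ⟶ Y) (f : J.obj X ⟶ Y) : X ⟶ Y :=
  casimir adj φ X ≫ T.map (J.map a ≫ f) ≫ b

theorem higmanTrace_add [Preadditive D] [T.toFunctor.Additive] {X Y : D} (a : T.obj X ⟶ X)
    (b : T.obj Y ⟶ Y) (f f' : J.obj X ⟶ Y) :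
    higmanTrace adj φ a b (f + f') = higmanTrace adj φ a b f + higmanTrace adj φ a b f' := by
  simp [higmanTrace]

theorem higmanTrace_smul {k : Type w} [Field k] [Preadditive D] [Linear k D]
    [T.toFunctor.Additive] [T.toFunctor.Linear k] {X Y : D} (a : T.obj X ⟶ X)
    (b : T.obj Y ⟶ Y) (r : k) (f : J.obj X ⟶ Y) :
    higmanTrace adj φ a b (r • f) = r • higmanTrace adj φ a b f := by
  simp [higmanTrace]

theorem higmanTrace_comp {X Y Z : D} (a : T.obj X ⟶ X) {b : T.obj Y ⟶ Y} {c : T.obj Z ⟶ Z}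
    (f : J.obj X ⟶ Y) {h : Y ⟶ Z} (hh : b ≫ h = T.map h ≫ c) :
    higmanTrace adj φ a b f ≫ h = higmanTrace adj φ a c (f ≫ h) := by
  simp [higmanTrace, hh]

theorem comp_higmanTrace {X X' Y : D} {a : T.obj X ⟶ X} {a' : T.obj X' ⟶ X'} {b : T.obj Y ⟶ Y}
    {h : X' ⟶ X} (hh : a' ≫ h = T.map h ≫ a) (f : J.obj X ⟶ Y) :
    h ≫ higmanTrace adj φ a b f = higmanTrace adj φ a' b (J.map h ≫ f) := by
  simp only [higmanTrace, reassoc_of% casimir_naturality adj φ, ← Functor.map_comp_assoc, ← hh]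

/-! ### Consequences of nondegeneracy: the Casimir copairing is central, and form and trace are
inverse on free modules. -/

variable {adj φ σ}
variable (hφ : ∀ d, φ.hom.app (T.obj d) ≫ adj.counit.app d = J.map (T.μ.app d) ≫ σ.app d)
include hφ

/-- By `hφ` the form after multiplication is the counit of `K ⊣ T` transported along `φ`, so this is
one triangle identity of that adjunction; `map_casimir_form'` is the other. -/
theorem casimir_mul_form (d : D) :
    casimir adj φ (T.obj d) ≫ T.map (J.map (T.μ.app d) ≫ σ.app d) = 𝟙 _ := by
  rw [← hφ]
  simp [casimir]

theorem map_casimir_form' (d : D) :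
    J.map (T.map (casimir adj φ d)) ≫ J.map (T.μ.app _) ≫ σ.app _ = 𝟙 (J.obj (T.obj d)) := by
  rw [← hφ, ← cancel_mono (φ.hom.app d)]
  have h := φ.hom.naturality (casimir adj φ d)
  simp only [Functor.comp_map] at h
  rw [reassoc_of% h]
  simp [casimir]

theorem map_casimir_form (d : D) :
    J.map (casimir adj φ d) ≫ σ.app (J.obj (T.obj d)) = J.map (T.η.app d) := by
  have h := J.map (T.η.app d) ≫= map_casimir_form' hφ d
  have h₂ := T.η.naturality (casimir adj φ d)
  simp only [Functor.id_map] at h₂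
  rw [← Functor.map_comp_assoc, ← h₂] at h
  simpa only [Functor.map_comp, ← Functor.map_comp_assoc, Category.assoc, T.left_unit, J.map_id,
    Category.id_comp, Category.comp_id] using h

/-- Centrality of the Casimir element: multiplying into its right leg or into its left leg gives the
same result. A second copairing is inserted on the right leg by `map_casimir_form'`, associativity
of `μ` moves the factor across, and `casimir_mul_form` removes the first copairing. -/
theorem casimir_mul (d : D) :
    casimir adj φ (T.obj d) ≫ T.map (J.map (T.μ.app d)) =
      T.map (casimir adj φ d) ≫ T.μ.app _ := by
  have h₁ : T.μ.app d ≫ T.map (casimir adj φ d) =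
      T.map (T.map (casimir adj φ d)) ≫ T.μ.app _ := (T.μ.naturality _).symm
  have h₂ : ∀ {x y : D} (f : x ⟶ y),
      f ≫ casimir adj φ y = casimir adj φ x ≫ T.map (J.map (T.map f)) :=
    fun f => casimir_naturality adj φ f
  calc _ = casimir adj φ (T.obj d) ≫ T.map (J.map (T.μ.app d)) ≫
        T.map (J.map (T.map (casimir adj φ d)) ≫ J.map (T.μ.app _) ≫ σ.app _) := by
          rw [map_casimir_form' hφ, T.map_id, Category.comp_id]
    _ = casimir adj φ (T.obj d) ≫ T.map (J.map (T.map (T.map (casimir adj φ d)))) ≫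
        T.map (J.map (T.μ.app _)) ≫ T.map (J.map (T.μ.app _)) ≫ T.map (σ.app _) := by
          simp only [← Functor.map_comp, ← Functor.map_comp_assoc, reassoc_of% h₁]
    _ = T.map (casimir adj φ d) ≫ T.μ.app _ ≫ casimir adj φ _ ≫
        T.map (J.map (T.μ.app _) ≫ σ.app _) := by
          rw [reassoc_of% h₂, ← reassoc_of% h₂]
          simp only [← Functor.map_comp, ← Functor.map_comp_assoc, T.assoc]
    _ = _ := by rw [casimir_mul_form hφ, Category.comp_id]

/-- Associativity of `b` turns the outer action into multiplication on the left leg of the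
copairing; centrality moves it to the right leg, where associativity of `a` absorbs it. -/
theorem higmanTrace_linear {X Y : D} {a : T.obj X ⟶ X} {b : T.obj Y ⟶ Y}
    (ha : IsMonadAction T a) (hb : IsMonadAction T b) (f : J.obj X ⟶ Y) :
    a ≫ higmanTrace adj φ a b f = T.map (higmanTrace adj φ a b f) ≫ b := by
  have h₁ : T.μ.app (J.obj (T.obj X)) ≫ T.map (J.map a ≫ f) =
    T.map (T.map (J.map a ≫ f)) ≫ T.μ.app _ := (T.μ.naturality _).symm
  simp only [higmanTrace, T.map_comp, Category.assoc, ← hb.assoc]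
  simp only [← T.map_comp, ← T.map_comp_assoc]
  rw [T.map_comp (casimir adj φ X), Category.assoc, ← reassoc_of% h₁, ← reassoc_of% casimir_mul hφ,
    reassoc_of% casimir_naturality adj φ]
  simp only [← Functor.map_comp_assoc, ha.assoc]

/-- Linearity of `g` moves the copairing from `X` to the free algebra `T Y`, where it cancels
against the form. -/
theorem higmanTrace_formMap {X Y : D} {a : T.obj X ⟶ X} {b : T.obj Y ⟶ Y} {g : X ⟶ T.obj Y}
    (hg : a ≫ g = T.map g ≫ T.μ.app Y) :
    higmanTrace adj φ a b (formMap σ g) = g ≫ b := by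
  simp only [higmanTrace, formMap]
  rw [← Functor.map_comp_assoc, hg, J.map_comp, Category.assoc, T.map_comp, Category.assoc,
    ← reassoc_of% casimir_naturality adj φ, reassoc_of% casimir_mul_form hφ]

/-- The form pairs with the left leg of the copairing and leaves the unit of `T`, which `a` absorbs.
Together with `higmanTrace_formMap` this identifies the linear maps `X ⟶ T y` with `Hom(J X, y)`. -/
theorem formMap_higmanTrace_unit {X y : D} {a : T.obj X ⟶ X} (ha : IsMonadAction T a)
    (f : J.obj X ⟶ y) :
    formMap σ (higmanTrace adj φ a (T.μ.app y) (f ≫ T.η.app y)) = f := by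
  have h₁ := σ.naturality (J.map a ≫ f)
  have h₂ : J.map (casimir adj φ X) ≫ σ.app (J.obj (T.obj X)) = J.map (T.η.app X) :=
    map_casimir_form hφ X
  simp only [Functor.comp_map, Functor.id_map] at h₁
  have h₃ : T.map (T.η.app y) ≫ T.μ.app y = 𝟙 (T.obj y) := T.right_unit y
  simp only [formMap, higmanTrace]
  rw [← Category.assoc _ f, T.map_comp, Category.assoc, h₃, Category.comp_id, J.map_comp,
    Category.assoc, h₁, reassoc_of% h₂, ← J.map_comp_assoc, ha.unit, J.map_id, Category.id_comp]

end Frobenius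

/-! ### Actions of a left adjoint of a left adjoint of a monad -/

section Mate

variable {L : D ⥤ D} (adj₁ : L ⊣ K) (adj : K ⊣ T.toFunctor)

/-- The map `Hom(W, T y) ⟶ Hom(W, y)` determined by a morphism `L W ⟶ W`, where `L` is left
adjoint to a left adjoint of `T`. -/
def mateMap {W : D} (a : L.obj W ⟶ W) {y : D} (h : W ⟶ T.obj y) : W ⟶ y :=
  adj₁.unit.app W ≫ K.map (a ≫ h) ≫ adj.counit.app y

/-- The data exhibiting the unit and the multiplication of `L` as the mates of those of `T`. -/
structure IsMonadMate (one : ∀ d, d ⟶ L.obj d) (mul : ∀ d, L.obj (L.obj d) ⟶ L.obj d)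
    (comul : K ⟶ K ⋙ K) : Prop where
  unit_counit (d : D) :
    adj₁.unit.app d ≫ K.map (T.η.app (L.obj d)) ≫ adj.counit.app (L.obj d) = one d
  map_mul_counit (d : D) : K.map (T.μ.app d) ≫ adj.counit.app d =
    comul.app (T.obj (T.obj d)) ≫ K.map (adj.counit.app (T.obj d)) ≫ adj.counit.app d
  unit_comul (d : D) : adj₁.unit.app d ≫ comul.app (L.obj d) =
    adj₁.unit.app d ≫ K.map (adj₁.unit.app (L.obj d)) ≫ K.map (K.map (mul d))

variable {adj₁ adj} {one : ∀ d, d ⟶ L.obj d} {mul : ∀ d, L.obj (L.obj d) ⟶ L.obj d}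
    {comul : K ⟶ K ⋙ K} (H : IsMonadMate adj₁ adj one mul comul)
include H

theorem mateMap_unit {W : D} (a : L.obj W ⟶ W) {y : D} (f : W ⟶ y) :
    mateMap adj₁ adj a (f ≫ T.η.app y) = one W ≫ a ≫ f := by
  have h₁ : a ≫ f ≫ T.η.app y = T.η.app _ ≫ T.map (a ≫ f) := by
    rw [← Category.assoc]; exact T.η.naturality (a ≫ f)
  have h₂ : K.map (T.map (a ≫ f)) ≫ adj.counit.app y = adj.counit.app _ ≫ a ≫ f :=
    adj.counit.naturality _
  simp only [mateMap]
  rw [h₁, K.map_comp, Category.assoc, h₂, ← H.unit_counit]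
  simp only [Category.assoc]

-- This and `mateMap_mul` bring both sides of the associativity law to a common shape, in which the
-- only difference is `L.map a ≫ a` against `mul W ≫ a`.
omit H in
theorem mateMap_mateMap {W : D} (a : L.obj W ⟶ W) {y : D} (h : W ⟶ T.obj (T.obj y)) :
    mateMap adj₁ adj a (mateMap adj₁ adj a h) =
      adj₁.unit.app W ≫ K.map (adj₁.unit.app (L.obj W)) ≫ K.map (K.map (L.map a ≫ a)) ≫
        K.map (K.map h) ≫ K.map (adj.counit.app _) ≫ adj.counit.app y := by
  have h₁ : a ≫ adj₁.unit.app W = adj₁.unit.app _ ≫ K.map (L.map a) := adj₁.unit.naturality a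
  simp only [mateMap, ← Functor.map_comp_assoc, Category.assoc]
  rw [reassoc_of% h₁]
  simp

theorem mateMap_mul {W : D} (a : L.obj W ⟶ W) {y : D} (h : W ⟶ T.obj (T.obj y)) :
    mateMap adj₁ adj a (h ≫ T.μ.app y) =
      adj₁.unit.app W ≫ K.map (adj₁.unit.app (L.obj W)) ≫ K.map (K.map (mul W ≫ a)) ≫
        K.map (K.map h) ≫ K.map (adj.counit.app _) ≫ adj.counit.app y := by
  have h₁ : K.map (a ≫ h) ≫ comul.app _ = comul.app _ ≫ K.map (K.map (a ≫ h)) :=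
    comul.naturality (a ≫ h)
  simp only [mateMap]
  rw [← Category.assoc a, K.map_comp, Category.assoc, H.map_mul_counit, reassoc_of% h₁,
    reassoc_of% H.unit_comul]
  simp

theorem mateMap_mateMap_of_action {W : D} {a : L.obj W ⟶ W} (ha : mul W ≫ a = L.map a ≫ a)
    {y : D} (h : W ⟶ T.obj (T.obj y)) :
    mateMap adj₁ adj a (mateMap adj₁ adj a h) = mateMap adj₁ adj a (h ≫ T.μ.app y) := by
  rw [mateMap_mateMap, mateMap_mul H, ha]

theorem action_of_mateMap {W : D} {a : L.obj W ⟶ W}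
    (h : ∀ {y : D} (h : W ⟶ T.obj (T.obj y)),
      mateMap adj₁ adj a (mateMap adj₁ adj a h) = mateMap adj₁ adj a (h ≫ T.μ.app y)) :
    mul W ≫ a = L.map a ≫ a := by
  -- The unit of `K K ⊣ T T` is the universal test map: with it the counits cancel, and what remains
  -- are the transposes of the two sides under `L L ⊣ K K`.
  have h' := h ((adj.comp adj).unit.app W)
  rw [mateMap_mateMap, mateMap_mul H] at h'
  have h₃ : K.map (K.map ((adj.comp adj).unit.app W)) ≫ K.map (adj.counit.app _) ≫
      adj.counit.app ((K ⋙ K).obj W) = 𝟙 (K.obj (K.obj W)) := by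
    have := (adj.comp adj).left_triangle_components W
    simpa using this
  rw [h₃, Category.comp_id, Category.comp_id] at h'
  have h₄ := ((adj₁.comp adj₁).homEquiv W W).injective (a₁ := mul W ≫ a) (a₂ := L.map a ≫ a)
  refine h₄ ?_
  simpa [Adjunction.homEquiv_unit] using h'.symm

end Mate

end MonadTrace

/-! ### The twisted action on a monad with a Frobenius trace -/

section Twist

variable {D : Type u} [Category.{v} D] {T : Monad D} {L K J P : D ⥤ D}
  {adj₁ : L ⊣ K} {adj : K ⊣ T.toFunctor} {φ : T.toFunctor ⋙ J ≅ K} {σ : T.toFunctor ⋙ J ⟶ 𝟭 D}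
  (adj₂ : P ⊣ J)

/-- The twisted action of `L` on `J X`, for a `T`-algebra `X`. -/
def monadTwist (φ : T.toFunctor ⋙ J ≅ K) (ψ : ∀ d, L.obj d ⟶ K.obj (P.obj d))
    {X : D} (a : T.obj X ⟶ X) : L.obj (J.obj X) ⟶ J.obj X :=
  ψ (J.obj X) ≫ φ.inv.app (P.obj (J.obj X)) ≫ J.map (T.map (adj₂.counit.app X)) ≫ J.map a

/-- The hypothesis `hψ` says that `ψ` is the mate of `φ`. Substituting it cancels the unit and
counit of `P ⊣ J`, and the unit of `K ⊣ T` followed by `φ⁻¹` is the Casimir copairing. -/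
theorem mateMap_monadTwist
    (hφ : ∀ d, φ.hom.app (T.obj d) ≫ adj.counit.app d = J.map (T.μ.app d) ≫ σ.app d)
    {ψ : ∀ d, L.obj d ⟶ K.obj (P.obj d)}
    (hψ : ∀ d, adj₁.unit.app d ≫ K.map (ψ d) =
      adj₂.unit.app d ≫ J.map (adj.unit.app (P.obj d)) ≫ φ.hom.app (K.obj (P.obj d)))
    {X : D} (a : T.obj X ⟶ X) {y : D} (h : J.obj X ⟶ T.obj y) :
    mateMap adj₁ adj (monadTwist adj₂ φ ψ a) h =
      formMap σ (higmanTrace adj φ a (T.μ.app y) h) := by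
  have n₁ : ∀ {x y : D} (f : x ⟶ y),
      φ.hom.app x ≫ K.map f = J.map (T.map f) ≫ φ.hom.app y := fun f => (φ.hom.naturality f).symm
  have n₂ : ∀ {x y : D} (f : x ⟶ y), φ.inv.app x ≫ J.map (T.map f) = K.map f ≫ φ.inv.app y :=
    fun f => (φ.inv.naturality f).symm
  have n₃ : adj.unit.app (P.obj (J.obj X)) ≫ T.map (K.map (adj₂.counit.app X)) =
      adj₂.counit.app X ≫ adj.unit.app X := (adj.unit.naturality _).symm
  have h₁ : adj₁.unit.app (J.obj X) ≫ K.map (ψ (J.obj X)) =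
      adj₂.unit.app (J.obj X) ≫ J.map (adj.unit.app (P.obj (J.obj X))) ≫
        φ.hom.app (K.obj (P.obj (J.obj X))) := hψ _
  have n₄ : adj₂.unit.app (J.obj X) ≫ J.map (adj₂.counit.app X) = 𝟙 (J.obj X) :=
    adj₂.right_triangle_components X
  have e : monadTwist adj₂ φ ψ a ≫ h = ψ (J.obj X) ≫ K.map (adj₂.counit.app X) ≫
      φ.inv.app X ≫ J.map a ≫ h := by
    simp only [monadTwist, Category.assoc, reassoc_of% n₂, Functor.id_obj]
  calc _ = adj₁.unit.app (J.obj X) ≫ K.map (ψ (J.obj X)) ≫ K.map (K.map (adj₂.counit.app X) ≫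
      φ.inv.app X ≫ J.map a ≫ h) ≫ adj.counit.app y := by
        simp only [mateMap, e, K.map_comp, Category.assoc]
    _ = adj₂.unit.app (J.obj X) ≫ J.map (adj.unit.app (P.obj (J.obj X)) ≫
          T.map (K.map (adj₂.counit.app X))) ≫ J.map (T.map (φ.inv.app X ≫ J.map a ≫ h)) ≫
          φ.hom.app (T.obj y) ≫ adj.counit.app y := by
        rw [reassoc_of% h₁, reassoc_of% n₁]
        simp only [Functor.map_comp, Category.assoc]
    _ = J.map (adj.unit.app X) ≫ J.map (T.map (φ.inv.app X ≫ J.map a ≫ h)) ≫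
          J.map (T.μ.app y) ≫ σ.app y := by
        rw [hφ, n₃, J.map_comp, Category.assoc, reassoc_of% n₄]
    _ = _ := by
        simp only [formMap, higmanTrace, casimir, Functor.map_comp, Category.assoc]

/-- In terms of mates, the unit law is the identity "form after trace of `f ≫ η` is `f`".
Associativity follows because `higmanTrace_formMap` applies to the trace of `f`, which is linear. -/
theorem monadTwist_action
    (hφ : ∀ d, φ.hom.app (T.obj d) ≫ adj.counit.app d = J.map (T.μ.app d) ≫ σ.app d)
    {ψ : ∀ d, L.obj d ⟶ K.obj (P.obj d)}
    (hψ : ∀ d, adj₁.unit.app d ≫ K.map (ψ d) =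
      adj₂.unit.app d ≫ J.map (adj.unit.app (P.obj d)) ≫ φ.hom.app (K.obj (P.obj d)))
    {one : ∀ d, d ⟶ L.obj d} {mul : ∀ d, L.obj (L.obj d) ⟶ L.obj d} {comul : K ⟶ K ⋙ K}
    (H : IsMonadMate adj₁ adj one mul comul) {X : D} {a : T.obj X ⟶ X} (ha : IsMonadAction T a) :
    one _ ≫ monadTwist adj₂ φ ψ a = 𝟙 _ ∧
      mul _ ≫ monadTwist adj₂ φ ψ a = L.map (monadTwist adj₂ φ ψ a) ≫ monadTwist adj₂ φ ψ a := by
  constructor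
  · have h := mateMap_unit H (monadTwist adj₂ φ ψ a) (𝟙 (J.obj X))
    rw [mateMap_monadTwist adj₂ hφ hψ, formMap_higmanTrace_unit hφ ha, Category.comp_id] at h
    exact h.symm
  · refine action_of_mateMap H fun {y} f => ?_
    rw [mateMap_monadTwist adj₂ hφ hψ, mateMap_monadTwist adj₂ hφ hψ,
      mateMap_monadTwist adj₂ hφ hψ, higmanTrace_formMap hφ
        (higmanTrace_linear hφ ha (isMonadAction_free T (T.obj y)) f),
      higmanTrace_comp _ _ _ _ (T.assoc y).symm]

end Twist

/-! ### The canonical morphism and the universal cowedge -/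

section CanonicalCowedge

variable {k : Type w} [Field k] {D : Type u} [Category.{v} D] [Preadditive D] [Linear k D]
  {T : Monad D} {L K R : D ⥤ D} (adj₁ : L ⊣ K) (adj : K ⊣ T.toFunctor) (adj₃ : T.toFunctor ⊣ R)
  {N : D ⥤ D} (hN : NakayamaStructure k N)

/-- `mateMap` as a linear map. -/
def mateLinear [K.Additive] [K.Linear k] {W : D} (a : L.obj W ⟶ W) (y : D) :
    (W ⟶ T.obj y) →ₗ[k] (W ⟶ y) :=
  canonicalHom adj₁ adj W y ∘ₗ Linear.leftComp k (T.obj y) a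

/-- Computes the action on `N W` on generators: it is dual to `mateMap`. Module laws for `N W`
thereby become laws for `mateMap`. -/
theorem map_cowedge_canonical [K.Additive] [K.Linear k] [R.Additive] [R.Linear k] {W : D}
    (a : L.obj W ⟶ W) (y : D) (ζ : Module.Dual k (W ⟶ y)) :
    T.map ((hN.cowedge W).app y ζ) ≫ canonical hN hN adj₁ adj adj₃ W ≫ N.map a =
      (hN.cowedge W).app (T.obj y) (ζ ∘ₗ mateLinear adj₁ adj a y) := by
  have h : T.map ((hN.cowedge W).app y ζ) ≫ canonical hN hN adj₁ adj adj₃ W =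
      (hN.cowedge (L.obj W)).app (T.obj y) (ζ ∘ₗ canonicalHom adj₁ adj W y) := by
    unfold canonical
    rw [← adj₃.homEquiv_naturality_left_symm, hN.fac, Equiv.symm_apply_eq,
      Adjunction.homEquiv_unit]
    rfl
  rw [reassoc_of% h, hN.natural]
  rfl

/-- The images under a left adjoint of the components of the universal cowedge are jointly
epimorphic. -/
theorem NakayamaStructure.map_hom_ext {F G : D ⥤ D} (adjF : F ⊣ G) {m z : D}
    {f g : F.obj (N.obj m) ⟶ z}
    (h : ∀ (x : D) (ξ : Module.Dual k (m ⟶ x)),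
      F.map ((hN.cowedge m).app x ξ) ≫ f = F.map ((hN.cowedge m).app x ξ) ≫ g) : f = g := by
  refine (adjF.homEquiv _ _).injective (hN.hom_ext fun x ξ => ?_)
  rw [← adjF.homEquiv_naturality_left, ← adjF.homEquiv_naturality_left, h]

/-- Both laws are tested on the universal cowedge. Dinaturality along `η` and `μ` moves these maps
inside the linear form, where the laws of `mateMap` apply. -/
theorem canonical_isMonadAction [K.Additive] [K.Linear k] [R.Additive] [R.Linear k]
    {one : ∀ d, d ⟶ L.obj d} {mul : ∀ d, L.obj (L.obj d) ⟶ L.obj d} {comul : K ⟶ K ⋙ K}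
    (H : IsMonadMate adj₁ adj one mul comul) {W : D} {a : L.obj W ⟶ W}
    (h₁ : one W ≫ a = 𝟙 W) (h₂ : mul W ≫ a = L.map a ≫ a) :
    IsMonadAction T (canonical hN hN adj₁ adj adj₃ W ≫ N.map a) where
  unit := by
    refine hN.hom_ext fun x ξ => ?_
    have n : (hN.cowedge W).app x ξ ≫ T.η.app (N.obj W) =
      T.η.app x ≫ T.map ((hN.cowedge W).app x ξ) := T.η.naturality _
    rw [reassoc_of% n, map_cowedge_canonical, ← (hN.cowedge W).dinatural, Category.comp_id]
    congr 1
    ext f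
    change ξ (mateMap adj₁ adj a (f ≫ T.η.app x)) = ξ f
    rw [mateMap_unit H, reassoc_of% h₁]
  assoc := by
    -- `T T` is a left adjoint, so it keeps the cowedge components jointly epimorphic.
    refine hN.map_hom_ext (adj₃.comp adj₃) fun x ξ => ?_
    have n : T.map (T.map ((hN.cowedge W).app x ξ)) ≫ T.μ.app (N.obj W) =
      T.μ.app x ≫ T.map ((hN.cowedge W).app x ξ) := T.μ.naturality _
    change T.map (T.map ((hN.cowedge W).app x ξ)) ≫ _ ≫ _ =
      T.map (T.map ((hN.cowedge W).app x ξ)) ≫ _ ≫ _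
    rw [reassoc_of% n, map_cowedge_canonical, ← T.map_comp_assoc, map_cowedge_canonical,
      map_cowedge_canonical, ← (hN.cowedge W).dinatural]
    congr 1
    ext f
    change ξ (mateMap adj₁ adj a (f ≫ T.μ.app x)) = ξ (mateMap adj₁ adj a (mateMap adj₁ adj a f))
    rw [mateMap_mateMap_of_action H h₂]

end CanonicalCowedge

/-! ### Identities between duals -/

section DualIdentities

variable {C : Type u₁} [Category.{v₁} C] [MonoidalCategory C]

section

variable (A : C) [MonObj A] [HasRightDual A]

theorem dualCounit_evaluation :
    (Aᘁ : C) ◁ η[A] ≫ ε_ A (Aᘁ : C) = (ρ_ (Aᘁ : C)).hom ≫ dualCounit A := by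
  have h := @rightAdjointMate_comp_evaluation C _ _ (𝟙_ C) A hasRightDualUnit _ η[A]
  change dualCounit A ▷ 𝟙_ C ≫ (ρ_ (𝟙_ C)).hom = _ at h
  rw [← h]
  simp

theorem dualComul_evaluation :
    (Aᘁ : C) ◁ μ[A] ≫ ε_ A (Aᘁ : C) = dualComul A ▷ (A ⊗ A) ≫
      (α_ (Aᘁ : C) (Aᘁ : C) (A ⊗ A)).hom ≫ (Aᘁ : C) ◁ (α_ (Aᘁ : C) A A).inv ≫
      (Aᘁ : C) ◁ ε_ A (Aᘁ : C) ▷ A ≫ (Aᘁ : C) ◁ (λ_ A).hom ≫ ε_ A (Aᘁ : C) := by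
  have h := @rightAdjointMate_comp_evaluation C _ _ (A ⊗ A) A hasRightDualTensor _ μ[A]
  refine h.symm.trans ?_
  change dualComul A ▷ (A ⊗ A) ≫ ε_ (A ⊗ A) ((Aᘁ : C) ⊗ (Aᘁ : C)) = _
  rw [ExactPairing.tensor_evaluation]
  monoidal

variable [HasRightDual (Aᘁ : C)]

theorem coevaluation_dualCounit :
    η_ (Aᘁ : C) ((Aᘁ : C)ᘁ : C) ≫ dualCounit A ▷ ((Aᘁ : C)ᘁ : C) =
      doubleDualOne A ≫ (λ_ _).inv := by
  have h := @coevaluation_comp_rightAdjointMate C _ _ (Aᘁ : C) (𝟙_ C) _ hasRightDualUnit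
    (dualCounit A)
  refine h.symm.trans ?_
  change (ρ_ (𝟙_ C)).inv ≫ 𝟙_ C ◁ doubleDualOne A = _
  simp [← unitors_inv_equal]

theorem coevaluation_dualComul :
    η_ (Aᘁ : C) ((Aᘁ : C)ᘁ : C) ≫ dualComul A ▷ ((Aᘁ : C)ᘁ : C) =
      η_ (Aᘁ : C) ((Aᘁ : C)ᘁ : C) ≫ (Aᘁ : C) ◁ (λ_ ((Aᘁ : C)ᘁ : C)).inv ≫
        (Aᘁ : C) ◁ η_ (Aᘁ : C) ((Aᘁ : C)ᘁ : C) ▷ ((Aᘁ : C)ᘁ : C) ≫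
        (Aᘁ : C) ◁ (α_ (Aᘁ : C) ((Aᘁ : C)ᘁ : C) ((Aᘁ : C)ᘁ : C)).hom ≫
        (α_ (Aᘁ : C) (Aᘁ : C) (((Aᘁ : C)ᘁ : C) ⊗ ((Aᘁ : C)ᘁ : C))).inv ≫
          ((Aᘁ : C) ⊗ (Aᘁ : C)) ◁ doubleDualMul A := by
  have h := @coevaluation_comp_rightAdjointMate C _ _ (Aᘁ : C) ((Aᘁ : C) ⊗ (Aᘁ : C)) _
    hasRightDualTensor (dualComul A)
  refine h.symm.trans ?_
  change η_ ((Aᘁ : C) ⊗ (Aᘁ : C)) (((Aᘁ : C)ᘁ : C) ⊗ ((Aᘁ : C)ᘁ : C)) ≫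
    ((Aᘁ : C) ⊗ (Aᘁ : C)) ◁ doubleDualMul A = _
  rw [ExactPairing.tensor_coevaluation]
  monoidal

end

variable [RigidCategory C] {A I : C} [MonObj A]

/-- Evaluating against `A` undoes the coevaluation in `φ` by the zigzag identity, leaving the
bilinear form `λ m`. -/
theorem frobeniusPhi_evaluation (lam : A ⟶ I) :
    frobeniusPhi lam ▷ A ≫ ε_ A (Aᘁ : C) =
      (α_ _ _ _).hom ≫ (Iᘁ : C) ◁ (μ[A] ≫ lam) ≫ ε_ I (Iᘁ : C) := by
  calc _ = 𝟙 _ ⊗≫ ((Iᘁ : C) ⊗ A) ◁ η_ A (Aᘁ : C) ▷ A ⊗≫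
        ((Iᘁ : C) ◁ (μ[A] ≫ lam) ▷ ((Aᘁ : C) ⊗ A) ⊗≫ (ε_ I (Iᘁ : C) ▷ ((Aᘁ : C) ⊗ A) ≫
          𝟙_ C ◁ ε_ A (Aᘁ : C))) ⊗≫ 𝟙 _ := by
        simp only [frobeniusPhi]; monoidal
    _ = 𝟙 _ ⊗≫ ((Iᘁ : C) ⊗ A) ◁ η_ A (Aᘁ : C) ▷ A ⊗≫
        ((Iᘁ : C) ◁ ((μ[A] ≫ lam) ▷ ((Aᘁ : C) ⊗ A) ≫ I ◁ ε_ A (Aᘁ : C))) ⊗≫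
          ε_ I (Iᘁ : C) ⊗≫ 𝟙 _ := by
        rw [← whisker_exchange]; monoidal
    _ = 𝟙 _ ⊗≫ ((Iᘁ : C) ⊗ A) ◁ (η_ A (Aᘁ : C) ▷ A ⊗≫ A ◁ ε_ A (Aᘁ : C)) ⊗≫
        (Iᘁ : C) ◁ (μ[A] ≫ lam) ⊗≫ ε_ I (Iᘁ : C) ⊗≫ 𝟙 _ := by
        rw [← whisker_exchange]; monoidal
    _ = _ := by
        rw [ExactPairing.evaluation_coevaluation'']; monoidal

/-- The dual `φ^∨ : A^∨∨ ⟶ (I^∨ ⊗ A)^∨ = A^∨ ⊗ I^∨∨` of the isomorphism of a Frobenius trace. -/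
def frobeniusDualHom {lam : A ⟶ I} (h : IsFrobeniusTrace lam) :
    ((Aᘁ : C)ᘁ : C) ⟶ (Aᘁ : C) ⊗ ((Iᘁ : C)ᘁ : C) :=
  (@dualIso C _ _ ((Iᘁ : C) ⊗ A) (Aᘁ : C) hasRightDualTensor _ (frobeniusIso h)).hom

/-- The characterization of `φ^∨` by coevaluations, with that of `I^∨ ⊗ A` written as `coev_A`
nested inside the coevaluation of `I^∨`. -/
theorem coevaluation_dual_frobenius {lam : A ⟶ I} (h : IsFrobeniusTrace lam) :
    η_ (Aᘁ : C) ((Aᘁ : C)ᘁ : C) ≫ (Aᘁ : C) ◁ frobeniusDualHom h =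
      η_ (Iᘁ : C) ((Iᘁ : C)ᘁ : C) ≫ (Iᘁ : C) ◁ (λ_ ((Iᘁ : C)ᘁ : C)).inv ≫
        (Iᘁ : C) ◁ η_ A (Aᘁ : C) ▷ ((Iᘁ : C)ᘁ : C) ≫
        (Iᘁ : C) ◁ (α_ A (Aᘁ : C) ((Iᘁ : C)ᘁ : C)).hom ≫
        (α_ (Iᘁ : C) A ((Aᘁ : C) ⊗ ((Iᘁ : C)ᘁ : C))).inv ≫
        frobeniusPhi lam ▷ ((Aᘁ : C) ⊗ ((Iᘁ : C)ᘁ : C)) := by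
  have h := @coevaluation_comp_rightAdjointMate C _ _ ((Iᘁ : C) ⊗ A) (Aᘁ : C)
    hasRightDualTensor _ (frobeniusPhi lam)
  refine h.trans ?_
  change η_ ((Iᘁ : C) ⊗ A) ((Aᘁ : C) ⊗ ((Iᘁ : C)ᘁ : C)) ≫ _ = _
  rw [ExactPairing.tensor_coevaluation]
  monoidal

end DualIdentities

/-! ### The monad of an algebra acting on a category -/

section ActionMonad

variable {C : Type u₁} [Category.{v₁} C] [MonoidalCategory C]
  (D : Type u₂) [Category.{v₂} D] [MonoidalLeftAction C D]

theorem action_assoc_inv_naturality (X Y : C) {d d' : D} (f : d ⟶ d') :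
    X ⊴ₗ Y ⊴ₗ f ≫ (αₗ X Y d').inv = (αₗ X Y d).inv ≫ (X ⊗ Y) ⊴ₗ f := by
  simp

theorem associator_hom_action (X Y Z : C) (d : D) :
    (α_ X Y Z).hom ⊵ₗ d =
      (αₗ (X ⊗ Y) Z d).hom ≫ (αₗ X Y (Z ⊙ₗ d)).hom ≫ X ⊴ₗ (αₗ Y Z d).inv ≫
        (αₗ X (Y ⊗ Z) d).inv := by
  simp [← associator_actionHom_assoc]

theorem leftUnitor_inv_action (X : C) (d : D) :
    (λ_ X).inv ⊵ₗ d = (λₗ (X ⊙ₗ d)).inv ≫ (αₗ (𝟙_ C) X d).inv := by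
  rw [← cancel_epi ((λ_ X).hom ⊵ₗ d), hom_inv_actionHomLeft, leftUnitor_actionHom]
  simp

/-- The unit of the monad `A ⊙ₗ -`. -/
def actionUnit (A : C) [MonObj A] : 𝟭 D ⟶ actionLeft D A where
  app d := (λₗ d).inv ≫ η[A] ⊵ₗ d
  naturality d d' f := by
    have h := action_exchange η[A] f
    rw [unit_actionHomRight, Category.assoc, Category.assoc, ← Iso.eq_inv_comp] at h
    change f ≫ (λₗ d').inv ≫ η[A] ⊵ₗ d' = ((λₗ d).inv ≫ η[A] ⊵ₗ d) ≫ A ⊴ₗ f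
    rw [h, Category.assoc]

/-- The multiplication of the monad `A ⊙ₗ -`. -/
def actionMul (A : C) [MonObj A] : actionLeft D A ⋙ actionLeft D A ⟶ actionLeft D A where
  app d := (αₗ A A d).inv ≫ μ[A] ⊵ₗ d
  naturality d d' f := by
    have h := action_exchange μ[A] f
    have h' := action_assoc_inv_naturality D A A f
    change A ⊴ₗ A ⊴ₗ f ≫ (αₗ A A d').inv ≫ μ[A] ⊵ₗ d' =
      ((αₗ A A d).inv ≫ μ[A] ⊵ₗ d) ≫ A ⊴ₗ f
    rw [reassoc_of% h', h, Category.assoc]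

theorem actionMul_assoc (A : C) [MonObj A] (d : D) :
    A ⊴ₗ ((αₗ A A d).inv ≫ μ[A] ⊵ₗ d) ≫ (αₗ A A d).inv ≫ μ[A] ⊵ₗ d =
      ((αₗ A A (A ⊙ₗ d)).inv ≫ μ[A] ⊵ₗ (A ⊙ₗ d)) ≫ (αₗ A A d).inv ≫ μ[A] ⊵ₗ d := by
  have h := congrArg (fun f => (αₗ A A (A ⊙ₗ d)).inv ≫ (αₗ (A ⊗ A) A d).inv ≫ f ⊵ₗ d)
    (MonObj.mul_assoc A)
  simp [whiskerRight_actionHomLeft, associator_hom_action, -actionHomLeft_action,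
    -associator_actionHom, -associator_actionHom_assoc,
    -MonObj.mul_assoc, -MonObj.one_mul, -MonObj.mul_one] at h
  simp [-actionHomLeft_action, -associator_actionHom, -associator_actionHom_assoc,
    -MonObj.mul_assoc, -MonObj.one_mul, -MonObj.mul_one, h]

theorem actionMul_left_unit (A : C) [MonObj A] (d : D) :
    ((λₗ (A ⊙ₗ d)).inv ≫ η[A] ⊵ₗ (A ⊙ₗ d)) ≫ (αₗ A A d).inv ≫ μ[A] ⊵ₗ d = 𝟙 (A ⊙ₗ d) := by
  have h := congrArg (fun f => (λₗ (A ⊙ₗ d)).inv ≫ (αₗ (𝟙_ C) A d).inv ≫ f ⊵ₗ d)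
    (MonObj.one_mul A)
  simpa [whiskerRight_actionHomLeft, associator_hom_action, associator_inv_action,
    leftUnitor_inv_action, -actionHomLeft_action, -associator_actionHom, -associator_actionHom_assoc,
    -MonObj.mul_assoc, -MonObj.one_mul, -MonObj.mul_one] using h

theorem actionMul_right_unit (A : C) [MonObj A] (d : D) :
    A ⊴ₗ ((λₗ d).inv ≫ η[A] ⊵ₗ d) ≫ (αₗ A A d).inv ≫ μ[A] ⊵ₗ d = 𝟙 (A ⊙ₗ d) := by
  have h := congrArg (fun f => A ⊴ₗ (λₗ d).inv ≫ (αₗ A (𝟙_ C) d).inv ≫ f ⊵ₗ d)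
    (MonObj.mul_one A)
  simpa [whiskerRight_actionHomLeft, associator_hom_action, associator_inv_action,
    leftUnitor_inv_action, -actionHomLeft_action, -associator_actionHom, -associator_actionHom_assoc,
    -MonObj.mul_assoc, -MonObj.one_mul, -MonObj.mul_one] using h

/-- The monad `A ⊙ₗ -` of an algebra `A`. -/
abbrev actionMonad (A : C) [MonObj A] : Monad D :=
  ⟨actionLeft D A, actionUnit D A, actionMul D A, actionMul_assoc D A, actionMul_left_unit D A,
    actionMul_right_unit D A⟩

theorem isModuleAction_iff {A : C} [MonObj A] {X : D} (a : A ⊙ₗ X ⟶ X) :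
    IsModuleAction A a ↔ IsMonadAction (actionMonad D A) a := by
  constructor
  · intro h
    refine ⟨?_, ?_⟩
    · change ((λₗ X).inv ≫ η[A] ⊵ₗ X) ≫ a = 𝟙 _
      rw [Category.assoc, h.one_smul, Iso.inv_hom_id]
    · change ((αₗ A A X).inv ≫ μ[A] ⊵ₗ X) ≫ a = A ⊴ₗ a ≫ a
      rw [Category.assoc, h.mul_smul, Iso.inv_hom_id_assoc]
  · intro h
    refine ⟨?_, ?_⟩
    · have := h.unit
      change ((λₗ X).inv ≫ η[A] ⊵ₗ X) ≫ a = 𝟙 _ at this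
      rwa [Category.assoc, Iso.inv_comp_eq, Category.comp_id] at this
    · have := h.assoc
      change ((αₗ A A X).inv ≫ μ[A] ⊵ₗ X) ≫ a = A ⊴ₗ a ≫ a at this
      rwa [Category.assoc, Iso.inv_comp_eq] at this

theorem isMonadAction_smul {A : C} [MonObj A] (X : Mod D A) :
    IsMonadAction (actionMonad D A) (ModObj.smul (M := A) (X := X.X)) :=
  (isModuleAction_iff D _).1 ⟨ModObj.one_smul X.X, ModObj.mul_smul X.X⟩

variable {D} in
theorem mod_smul_hom {A : C} [MonObj A] {X Y : Mod D A} (f : X ⟶ Y) :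
    ModObj.smul (M := A) (X := X.X) ≫ f.hom = A ⊴ₗ f.hom ≫ ModObj.smul (M := A) (X := Y.X) :=
  IsModHom.smul_hom

variable {D} in
/-- The free `A`-module on an object. -/
abbrev freeMod (A : C) [MonObj A] (y : D) : Mod D A :=
  modOfAction A (X := A ⊙ₗ y) ((actionMonad D A).μ.app y)
    ((isModuleAction_iff D _).2 (isMonadAction_free (actionMonad D A) y))

variable {D} in
/-- The morphism of free modules induced by a morphism. -/
def freeModMap (A : C) [MonObj A] {y z : D} (f : y ⟶ z) : freeMod A y ⟶ freeMod A z :=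
  Mod.Hom.mk' (A ⊴ₗ f) ((actionMonad D A).μ.naturality f).symm

variable {D} in
/-- The action of `A` on `Y` as a morphism of `A`-modules. -/
def actMod {A : C} [MonObj A] (Y : Mod D A) : freeMod A Y.X ⟶ Y :=
  Mod.Hom.mk' (ModObj.smul (M := A) (X := Y.X)) (isMonadAction_smul D Y).assoc

variable {D} in
/-- The unit `y ⟶ A ⊙ y` of the free module on `y`. -/
def freeUnit (A : C) [MonObj A] (y : D) : y ⟶ A ⊙ₗ y := (actionMonad D A).η.app y

variable {D} in
theorem freeUnit_smul {A : C} [MonObj A] (Z : Mod D A) :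
    freeUnit A Z.X ≫ ModObj.smul (M := A) (X := Z.X) = 𝟙 Z.X :=
  (isMonadAction_smul D Z).unit

variable (A : C) [MonObj A] [HasRightDual A] [HasRightDual (Aᘁ : C)]

/-- The transformation `A^∨ ⊙ - ⟶ A^∨ ⊙ A^∨ ⊙ -` given by the dual of the multiplication. -/
def actionComul : actionLeft D (Aᘁ : C) ⟶ actionLeft D (Aᘁ : C) ⋙ actionLeft D (Aᘁ : C) where
  app d := dualComul A ⊵ₗ d ≫ (αₗ _ _ d).hom
  naturality d d' f := by
    have h := action_exchange (dualComul A) f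
    change (Aᘁ : C) ⊴ₗ f ≫ dualComul A ⊵ₗ d' ≫ (αₗ _ _ d').hom =
      (dualComul A ⊵ₗ d ≫ (αₗ _ _ d).hom) ≫ (Aᘁ : C) ⊴ₗ (Aᘁ : C) ⊴ₗ f
    rw [reassoc_of% h]
    simp

/-- The algebra structure of `A^∨∨` comes from dualizing twice. The first dualization is expressed
by evaluations of `A`, the second by coevaluations of `A^∨`; acting with these identities on `d`
gives the required mates. -/
theorem isMonadMate_action :
    IsMonadMate (T := actionMonad D A) (actionAdj D (Aᘁ : C) ((Aᘁ : C)ᘁ : C))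
      (actionAdj D A (Aᘁ : C)) (actionMonad D ((Aᘁ : C)ᘁ : C)).η.app
      (actionMonad D ((Aᘁ : C)ᘁ : C)).μ.app (actionComul D A) where
  unit_counit d := by
    have h₁ := congrArg (fun f => (Aᘁ : C) ⊴ₗ (λₗ (((Aᘁ : C)ᘁ : C) ⊙ₗ d)).inv ≫
      (αₗ _ _ _).inv ≫ f ⊵ₗ (((Aᘁ : C)ᘁ : C) ⊙ₗ d)) (dualCounit_evaluation A)
    have h₂ := congrArg (fun f => (λₗ d).inv ≫ f ⊵ₗ d ≫ (αₗ _ _ _).hom ≫ (λₗ _).hom)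
      (coevaluation_dualCounit A)
    change ((λₗ d).inv ≫ η_ _ _ ⊵ₗ d ≫ (αₗ _ _ d).hom) ≫
      (Aᘁ : C) ⊴ₗ ((λₗ (((Aᘁ : C)ᘁ : C) ⊙ₗ d)).inv ≫ η[A] ⊵ₗ (((Aᘁ : C)ᘁ : C) ⊙ₗ d)) ≫
        (αₗ _ _ _).inv ≫ ε_ _ _ ⊵ₗ (((Aᘁ : C)ᘁ : C) ⊙ₗ d) ≫ (λₗ (((Aᘁ : C)ᘁ : C) ⊙ₗ d)).hom =
      (λₗ d).inv ≫ doubleDualOne A ⊵ₗ d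
    simp [whiskerRight_actionHomLeft, leftUnitor_inv_action, -actionHomLeft_action,
      -associator_actionHom, -associator_actionHom_assoc] at h₁ h₂ ⊢
    rw [reassoc_of% h₁, h₂]
  map_mul_counit d := by
    have h := congrArg (fun f => (Aᘁ : C) ⊴ₗ (αₗ A A d).inv ≫ (αₗ _ _ _).inv ≫ f ⊵ₗ d ≫ (λₗ d).hom)
      (dualComul_evaluation A)
    change (Aᘁ : C) ⊴ₗ ((αₗ A A d).inv ≫ μ[A] ⊵ₗ d) ≫ (αₗ _ _ _).inv ≫ ε_ _ _ ⊵ₗ d ≫ (λₗ d).hom =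
      (dualComul A ⊵ₗ (A ⊙ₗ A ⊙ₗ d) ≫ (αₗ _ _ _).hom) ≫
        (Aᘁ : C) ⊴ₗ ((αₗ _ _ _).inv ≫ ε_ _ _ ⊵ₗ (A ⊙ₗ d) ≫ (λₗ (A ⊙ₗ d)).hom) ≫
        (αₗ _ _ _).inv ≫ ε_ _ _ ⊵ₗ d ≫ (λₗ d).hom
    simp [whiskerRight_actionHomLeft, associator_hom_action, associator_inv_action,
      -actionHomLeft_action, -associator_actionHom, -associator_actionHom_assoc] at h ⊢
    exact h
  unit_comul d := by
    have h := congrArg (fun f => (λₗ d).inv ≫ f ⊵ₗ d ≫ (αₗ _ _ _).hom ≫ (αₗ _ _ _).hom)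
      (coevaluation_dualComul A)
    change ((λₗ d).inv ≫ η_ _ _ ⊵ₗ d ≫ (αₗ _ _ d).hom) ≫
      dualComul A ⊵ₗ (((Aᘁ : C)ᘁ : C) ⊙ₗ d) ≫ (αₗ _ _ _).hom =
      ((λₗ d).inv ≫ η_ _ _ ⊵ₗ d ≫ (αₗ _ _ d).hom) ≫ (Aᘁ : C) ⊴ₗ
        ((λₗ (((Aᘁ : C)ᘁ : C) ⊙ₗ d)).inv ≫ η_ _ _ ⊵ₗ (((Aᘁ : C)ᘁ : C) ⊙ₗ d) ≫
          (αₗ _ _ (((Aᘁ : C)ᘁ : C) ⊙ₗ d)).hom) ≫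
        (Aᘁ : C) ⊴ₗ (Aᘁ : C) ⊴ₗ ((αₗ _ _ d).inv ≫ doubleDualMul A ⊵ₗ d)
    simp [whiskerRight_actionHomLeft, associator_hom_action, associator_inv_action,
    leftUnitor_inv_action, -actionHomLeft_action, -associator_actionHom, -associator_actionHom_assoc] at h ⊢
    exact h

end ActionMonad

/-! ### Frobenius traces on algebras -/

section AlgebraTrace

variable {C : Type u₁} [Category.{v₁} C] [MonoidalCategory C] [RigidCategory C]
  (D : Type u₂) [Category.{v₂} D] [MonoidalLeftAction C D] {A I : C} [MonObj A]

/-- The natural isomorphism `I^∨ ⊙ A ⊙ - ≅ A^∨ ⊙ -` of a Frobenius trace. -/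
def frobeniusNatIso {lam : A ⟶ I} (h : IsFrobeniusTrace lam) :
    (actionMonad D A).toFunctor ⋙ actionLeft D (Iᘁ : C) ≅ actionLeft D (Aᘁ : C) :=
  NatIso.ofComponents
    (fun d => (αₗ (Iᘁ : C) A d).symm ≪≫ ((curriedAction C D).mapIso (frobeniusIso h)).app d)
    fun {d d'} f => by
      have h₁ := action_assoc_inv_naturality D (Iᘁ : C) A f
      have h₂ := action_exchange (frobeniusPhi lam) f
      change (Iᘁ : C) ⊴ₗ A ⊴ₗ f ≫ (αₗ _ _ _).inv ≫ frobeniusPhi lam ⊵ₗ d' =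
        ((αₗ _ _ _).inv ≫ frobeniusPhi lam ⊵ₗ d) ≫ (Aᘁ : C) ⊴ₗ f
      rw [reassoc_of% h₁, h₂, Category.assoc]

/-- The transformation `I^∨ ⊙ A ⊙ - ⟶ -` given by a morphism `A ⟶ I` and the evaluation of `I`. -/
def traceForm (lam : A ⟶ I) : (actionMonad D A).toFunctor ⋙ actionLeft D (Iᘁ : C) ⟶ 𝟭 D where
  app d := (Iᘁ : C) ⊴ₗ lam ⊵ₗ d ≫ (actionAdj D I (Iᘁ : C)).counit.app d
  naturality d d' f := by
    have h₁ := (actionAdj D I (Iᘁ : C)).counit.naturality f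
    have h₂ := congrArg (fun g => (Iᘁ : C) ⊴ₗ g) (action_exchange lam f)
    simp only [actionHomRight_comp] at h₂
    change (Iᘁ : C) ⊴ₗ I ⊴ₗ f ≫ (αₗ _ _ _).inv ≫ ε_ I (Iᘁ : C) ⊵ₗ d' ≫ (λₗ d').hom =
      ((αₗ _ _ _).inv ≫ ε_ I (Iᘁ : C) ⊵ₗ d ≫ (λₗ d).hom) ≫ f at h₁
    change (Iᘁ : C) ⊴ₗ A ⊴ₗ f ≫ (Iᘁ : C) ⊴ₗ lam ⊵ₗ d' ≫
        (αₗ _ _ _).inv ≫ ε_ I (Iᘁ : C) ⊵ₗ d' ≫ (λₗ d').hom =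
      ((Iᘁ : C) ⊴ₗ lam ⊵ₗ d ≫ (αₗ _ _ _).inv ≫ ε_ I (Iᘁ : C) ⊵ₗ d ≫ (λₗ d).hom) ≫ f
    rw [reassoc_of% h₂, h₁]
    simp only [Category.assoc]

/-- Supplies the hypothesis `hφ` of the monad lemmas; `unit_frobeniusDual` supplies `hψ`. -/
theorem frobeniusNatIso_counit {lam : A ⟶ I} (h : IsFrobeniusTrace lam) (d : D) :
    (frobeniusNatIso D h).hom.app ((actionMonad D A).obj d) ≫
        (actionAdj D A (Aᘁ : C)).counit.app d =
      (actionLeft D (Iᘁ : C)).map ((actionMonad D A).μ.app d) ≫ (traceForm D lam).app d := by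
  have h := congrArg (fun f => (αₗ _ _ _).inv ≫ (αₗ _ _ _).inv ≫ f ⊵ₗ d ≫ (λₗ d).hom)
    (frobeniusPhi_evaluation lam)
  change ((αₗ _ _ _).inv ≫ frobeniusPhi lam ⊵ₗ (A ⊙ₗ d)) ≫
      (αₗ _ _ _).inv ≫ ε_ A (Aᘁ : C) ⊵ₗ d ≫ (λₗ d).hom =
    (Iᘁ : C) ⊴ₗ ((αₗ _ _ _).inv ≫ μ[A] ⊵ₗ d) ≫ (Iᘁ : C) ⊴ₗ lam ⊵ₗ d ≫
      (αₗ _ _ _).inv ≫ ε_ I (Iᘁ : C) ⊵ₗ d ≫ (λₗ d).hom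
  simpa [whiskerRight_actionHomLeft, associator_hom_action, associator_inv_action,
    leftUnitor_inv_action, -actionHomLeft_action, -associator_actionHom,
    -associator_actionHom_assoc] using h

/-- The transformation `A^∨∨ ⊙ - ⟶ A^∨ ⊙ I^∨∨ ⊙ -` given by `φ^∨`. -/
def frobeniusDual {lam : A ⟶ I} (h : IsFrobeniusTrace lam) (d : D) :
    ((Aᘁ : C)ᘁ : C) ⊙ₗ d ⟶ (Aᘁ : C) ⊙ₗ ((Iᘁ : C)ᘁ : C) ⊙ₗ d :=
  frobeniusDualHom h ⊵ₗ d ≫ (αₗ (Aᘁ : C) ((Iᘁ : C)ᘁ : C) d).hom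

theorem unit_frobeniusDual {lam : A ⟶ I} (h : IsFrobeniusTrace lam) (d : D) :
    (actionAdj D (Aᘁ : C) ((Aᘁ : C)ᘁ : C)).unit.app d ≫
        (actionLeft D (Aᘁ : C)).map (frobeniusDual D h d) =
      (actionAdj D (Iᘁ : C) ((Iᘁ : C)ᘁ : C)).unit.app d ≫
        (actionLeft D (Iᘁ : C)).map ((actionAdj D A (Aᘁ : C)).unit.app _) ≫
          (frobeniusNatIso D h).hom.app _ := by
  have h' := congrArg (fun f => (λₗ d).inv ≫ f ⊵ₗ d ≫ (αₗ _ _ _).hom ≫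
    (Aᘁ : C) ⊴ₗ (αₗ _ _ _).hom) (coevaluation_dual_frobenius h)
  change ((λₗ d).inv ≫ η_ _ _ ⊵ₗ d ≫ (αₗ _ _ d).hom) ≫ (Aᘁ : C) ⊴ₗ (frobeniusDualHom h ⊵ₗ d ≫
      (αₗ (Aᘁ : C) ((Iᘁ : C)ᘁ : C) d).hom) =
    ((λₗ d).inv ≫ η_ _ _ ⊵ₗ d ≫ (αₗ _ _ d).hom) ≫
      (Iᘁ : C) ⊴ₗ ((λₗ _).inv ≫ η_ _ _ ⊵ₗ (((Iᘁ : C)ᘁ : C) ⊙ₗ d) ≫ (αₗ _ _ _).hom) ≫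
      (αₗ _ _ _).inv ≫ frobeniusPhi lam ⊵ₗ _
  simpa [whiskerRight_actionHomLeft, associator_hom_action, associator_inv_action,
    leftUnitor_inv_action, -actionHomLeft_action, -associator_actionHom,
    -associator_actionHom_assoc] using h'

variable {D}

/-- Splitting `ν` into `φ^∨` followed by `φ⁻¹` recovers the two factors of `monadTwist`; only module
associators differ. -/
theorem twistedAction_eq {lam : A ⟶ I} (h : IsFrobeniusTrace lam) (X : Mod D A) :
    twistedAction h X =
      monadTwist (T := actionMonad D A) (L := actionLeft D ((Aᘁ : C)ᘁ : C))
        (actionAdj D (Iᘁ : C) ((Iᘁ : C)ᘁ : C)) (frobeniusNatIso D h) (frobeniusDual D h)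
        (ModObj.smul (M := A) (X := X.X)) := by
  have h₁ : (nakayamaIso h).hom = frobeniusDualHom h ≫ (frobeniusIso h).inv ▷ ((Iᘁ : C)ᘁ : C) := rfl
  have h₂ : monadTwist (T := actionMonad D A) (L := actionLeft D ((Aᘁ : C)ᘁ : C))
        (actionAdj D (Iᘁ : C) ((Iᘁ : C)ᘁ : C)) (frobeniusNatIso D h) (frobeniusDual D h)
        (ModObj.smul (M := A) (X := X.X)) =
      (frobeniusDualHom h ⊵ₗ ((Iᘁ : C) ⊙ₗ X.X) ≫ (αₗ _ _ _).hom) ≫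
        ((frobeniusIso h).inv ⊵ₗ _ ≫ (αₗ _ _ _).hom) ≫
        (Iᘁ : C) ⊴ₗ A ⊴ₗ ((αₗ ((Iᘁ : C)ᘁ : C) (Iᘁ : C) X.X).inv ≫
          ε_ (Iᘁ : C) ((Iᘁ : C)ᘁ : C) ⊵ₗ X.X ≫ (λₗ X.X).hom) ≫
        (Iᘁ : C) ⊴ₗ ModObj.smul (M := A) (X := X.X) := rfl
  rw [h₂, twistedAction, h₁, comp_actionHomLeft, whiskerRight_actionHomLeft]
  simp

theorem mateMap_twistedAction {lam : A ⟶ I} (h : IsFrobeniusTrace lam) (X : Mod D A) {y : D}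
    (f : (Iᘁ : C) ⊙ₗ X.X ⟶ A ⊙ₗ y) :
    mateMap (T := actionMonad D A) (actionAdj D (Aᘁ : C) ((Aᘁ : C)ᘁ : C))
        (actionAdj D A (Aᘁ : C)) (twistedAction h X) f =
      formMap (traceForm D lam) (higmanTrace (actionAdj D A (Aᘁ : C)) (frobeniusNatIso D h)
        (ModObj.smul (M := A) (X := X.X)) ((actionMonad D A).μ.app y) f) := by
  rw [twistedAction_eq]
  exact mateMap_monadTwist _ (frobeniusNatIso_counit D h) (unit_frobeniusDual D h) _ _

theorem isModuleAction_twistedAction {lam : A ⟶ I} (h : IsFrobeniusTrace lam) (X : Mod D A) :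
    IsModuleAction ((Aᘁ : C)ᘁ : C) (twistedAction h X) := by
  rw [isModuleAction_iff, twistedAction_eq]
  obtain ⟨h₁, h₂⟩ := monadTwist_action (T := actionMonad D A)
    (actionAdj D (Iᘁ : C) ((Iᘁ : C)ᘁ : C)) (frobeniusNatIso_counit D h)
    (unit_frobeniusDual D h) (isMonadMate_action D A) (isMonadAction_smul D X)
  exact ⟨h₁, h₂⟩

end AlgebraTrace

/-! ### The Nakayama functor of the category of modules -/

section ModuleNakayama

variable {k : Type w} [Field k] {C : Type u₁} [Category.{v₁} C] [MonoidalCategory C]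
  [RigidCategory C] [Preadditive C] [Linear k C]
  {M : Type u₂} [Category.{v₂} M] [Preadditive M] [Linear k M] [MonoidalLeftAction C M]
  [ActionPreadditive C M] [ActionLinear k C M] {A I : C} [MonObj A]
  {N : M ⥤ M} (hN : NakayamaStructure k N)

theorem isModuleAction_liftedAction (X : Mod M ((Aᘁ : C)ᘁ : C)) :
    IsModuleAction A (liftedAction hN X) := by
  have h := isMonadAction_smul M X
  exact (isModuleAction_iff M _).2 (canonical_isMonadAction (T := actionMonad M A) _ _
    (actionAdj M (ᘁA : C) A) hN (isMonadMate_action M A) h.unit h.assoc)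

theorem map_cowedge_liftedAction (X : Mod M ((Aᘁ : C)ᘁ : C)) (y : M)
    (ζ : Module.Dual k (X.X ⟶ y)) :
    A ⊴ₗ (hN.cowedge X.X).app y ζ ≫ liftedAction hN X =
      (hN.cowedge X.X).app (A ⊙ₗ y) (ζ ∘ₗ mateLinear (T := actionMonad M A)
        (actionAdj M (Aᘁ : C) ((Aᘁ : C)ᘁ : C)) (actionAdj M A (Aᘁ : C))
        (ModObj.smul (M := ((Aᘁ : C)ᘁ : C)) (X := X.X)) y) :=
  map_cowedge_canonical (T := actionMonad M A) _ _ (actionAdj M (ᘁA : C) A) hN _ y ζ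

variable (k) in
/-- The map `Hom_A(X, A ⊙ y) ⟶ Hom(I^∨ ⊙ X, y)` given by a morphism `A ⟶ I`. -/
def formLinear (lam : A ⟶ I) (X : Mod M A) (y : M) :
    (X ⟶ freeMod A y) →ₗ[k] ((Iᘁ : C) ⊙ₗ X.X ⟶ y) where
  toFun g := formMap (traceForm M lam) (X := X.X) (y := y) g.hom
  map_add' g g' := formMap_add (traceForm M lam) g.hom g'.hom
  map_smul' r g := formMap_smul (traceForm M lam) r g.hom

variable (k) in
/-- The Higman trace `Hom(I^∨ ⊙ X, Y) ⟶ Hom_A(X, Y)` of a Frobenius trace on `A`. -/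
def traceLinear {lam : A ⟶ I} (h : IsFrobeniusTrace lam) (X Y : Mod M A) :
    ((Iᘁ : C) ⊙ₗ X.X ⟶ Y.X) →ₗ[k] (X ⟶ Y) where
  toFun f := Mod.Hom.mk'
    (higmanTrace (T := actionMonad M A) (actionAdj M A (Aᘁ : C)) (frobeniusNatIso M h)
      (ModObj.smul (M := A) (X := X.X)) (ModObj.smul (M := A) (X := Y.X)) f)
    (higmanTrace_linear (frobeniusNatIso_counit M h) (isMonadAction_smul M X)
      (isMonadAction_smul M Y) f)
  map_add' f f' := Mod.hom_ext _ _ (higmanTrace_add (T := actionMonad M A) (actionAdj M A (Aᘁ : C))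
    (frobeniusNatIso M h) _ _ f f')
  map_smul' r f := Mod.hom_ext _ _ (higmanTrace_smul (T := actionMonad M A) (actionAdj M A (Aᘁ : C))
    (frobeniusNatIso M h) _ _ r f)

section Identities

variable {lam : A ⟶ I} (h : IsFrobeniusTrace lam) {X : Mod M A}

theorem traceLinear_formLinear (Y : Mod M A) (g : X ⟶ freeMod A Y.X) :
    traceLinear k h X Y (formLinear k lam X Y.X g) = g ≫ actMod Y :=
  Mod.hom_ext _ _ (higmanTrace_formMap (frobeniusNatIso_counit M h) (mod_smul_hom g))

theorem formLinear_traceLinear_unit {y : M} (f : (Iᘁ : C) ⊙ₗ X.X ⟶ y) :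
    formLinear k lam X y (traceLinear k h X (freeMod A y) (f ≫ freeUnit A y)) = f :=
  formMap_higmanTrace_unit (frobeniusNatIso_counit M h) (isMonadAction_smul M X) f

theorem traceLinear_comp {Y Z : Mod M A} (f : (Iᘁ : C) ⊙ₗ X.X ⟶ Y.X) (g : Y ⟶ Z) :
    traceLinear k h X Y f ≫ g = traceLinear k h X Z (f ≫ g.hom) :=
  Mod.hom_ext _ _ (higmanTrace_comp (T := actionMonad M A) (actionAdj M A (Aᘁ : C))
    (frobeniusNatIso M h) _ f (mod_smul_hom g))

theorem comp_traceLinear {X' Y : Mod M A} (f : (Iᘁ : C) ⊙ₗ X.X ⟶ Y.X) (g : X' ⟶ X) :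
    g ≫ traceLinear k h X Y f = traceLinear k h X' Y ((Iᘁ : C) ⊴ₗ g.hom ≫ f) :=
  Mod.hom_ext _ _ (comp_higmanTrace (T := actionMonad M A) (actionAdj M A (Aᘁ : C))
    (frobeniusNatIso M h) (mod_smul_hom g) f)

theorem formLinear_comp {y z : M} (g : X ⟶ freeMod A y) (f : y ⟶ z) :
    formLinear k lam X z (g ≫ freeModMap A f) = formLinear k lam X y g ≫ f :=
  formMap_comp_map (traceForm M lam) g.hom f

theorem mateLinear_twistedAction {y : M} (f : (Iᘁ : C) ⊙ₗ X.X ⟶ A ⊙ₗ y) :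
    mateLinear (k := k) (T := actionMonad M A)
        (actionAdj M (Aᘁ : C) ((Aᘁ : C)ᘁ : C)) (actionAdj M A (Aᘁ : C)) (twistedAction h X) y f =
      formLinear k lam X y (traceLinear k h X (freeMod A y) f) :=
  mateMap_twistedAction h X f

end Identities

/-! ### The universal cowedge on modules. -/

variable {lam : A ⟶ I} (h : IsFrobeniusTrace lam)
  (h₁ : ∀ X : Mod M A, IsModuleAction ((Aᘁ : C)ᘁ : C) (twistedAction h X))
  (h₂ : ∀ X : Mod M ((Aᘁ : C)ᘁ : C), IsModuleAction A (liftedAction hN X))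

theorem map_cowedge_smul (X : Mod M A) (y : M) (ζ : Module.Dual k ((Iᘁ : C) ⊙ₗ X.X ⟶ y)) :
    A ⊴ₗ (hN.cowedge ((Iᘁ : C) ⊙ₗ X.X)).app y ζ ≫
        ModObj.smul (M := A) (X := ((twistFunctor h h₁ ⋙ liftFunctor hN h₂).obj X).X) =
      (hN.cowedge ((Iᘁ : C) ⊙ₗ X.X)).app (A ⊙ₗ y)
        (ζ ∘ₗ formLinear k lam X y ∘ₗ traceLinear k h X (freeMod A y)) := by
  refine (map_cowedge_liftedAction hN ((twistFunctor h h₁).obj X) y ζ).trans ?_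
  refine congrArg _ (LinearMap.ext fun f => congrArg ζ ?_)
  exact mateLinear_twistedAction h f

/-- The component of the universal cowedge of the Nakayama functor of `A`-modules. -/
def moduleCowedge (X : Mod M A) :
    NakayamaCowedge k X ((twistFunctor h h₁ ⋙ liftFunctor hN h₂).obj X) where
  app Y :=
    { toFun ξ := Mod.Hom.mk' ((hN.cowedge _).app Y.X (ξ ∘ₗ traceLinear k h X Y)) <| by
        -- Linearity: by dinaturality along the action of `Y`, both sides are cowedge components at
        -- `A ⊙ Y`. Their linear forms agree because the trace commutes with the linear map `actMod
        -- Y` and trace after form is composition with it.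
        refine Eq.trans ?_ (map_cowedge_smul hN h h₁ h₂ X Y.X _).symm
        refine ((hN.cowedge ((Iᘁ : C) ⊙ₗ X.X)).dinatural _ _).symm.trans ?_
        refine congrArg _ (LinearMap.ext fun f => congrArg ξ ?_)
        change traceLinear k h X Y (f ≫ (actMod Y).hom) =
          traceLinear k h X Y (formLinear k lam X Y.X (traceLinear k h X (freeMod A Y.X) f))
        rw [traceLinear_formLinear]
        exact (traceLinear_comp (k := k) h f (actMod Y)).symm
      map_add' ξ ξ' := Mod.hom_ext _ _ (by
        change (hN.cowedge _).app Y.X ((ξ + ξ') ∘ₗ traceLinear k h X Y) = _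
        rw [LinearMap.add_comp, map_add]
        rfl)
      map_smul' r ξ := Mod.hom_ext _ _ (by
        change (hN.cowedge _).app Y.X ((r • ξ) ∘ₗ traceLinear k h X Y) = _
        rw [LinearMap.smul_comp, map_smul]
        rfl) }
  dinatural {Y Z} f ξ := Mod.hom_ext _ _ <| by
    change (hN.cowedge _).app Y.X _ = f.hom ≫ (hN.cowedge _).app Z.X _
    rw [← (hN.cowedge _).dinatural]
    refine congrArg _ (LinearMap.ext fun g => congrArg ξ ?_)
    exact traceLinear_comp h g f

theorem moduleCowedge_hom (X Y : Mod M A) (ξ : Module.Dual k (X ⟶ Y)) :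
    ((moduleCowedge hN h h₁ h₂ X).app Y ξ).hom =
      (hN.cowedge ((Iᘁ : C) ⊙ₗ X.X)).app Y.X (ξ ∘ₗ traceLinear k h X Y) := rfl

/-- The cowedge on `M` obtained by restricting a cowedge on `A`-modules to free modules. -/
def freeCowedge (lam : A ⟶ I) {X Z : Mod M A} (s : NakayamaCowedge k X Z) :
    NakayamaCowedge k ((Iᘁ : C) ⊙ₗ X.X) Z.X where
  app y :=
    { toFun ζ := freeUnit A y ≫ (s.app (freeMod A y) (ζ ∘ₗ formLinear k lam X y)).hom
      map_add' ζ ζ' := by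
        rw [LinearMap.add_comp, map_add]
        exact Preadditive.comp_add _ _ _ _ _ _
      map_smul' r ζ := by
        rw [LinearMap.smul_comp, map_smul]
        exact Linear.comp_smul _ _ _ _ _ _ }
  dinatural {y z} f ζ := by
    have h₁ : f ≫ freeUnit A z = freeUnit A y ≫ (freeModMap A f).hom :=
      (actionMonad M A).η.naturality f
    have h₂ := congrArg Mod.Hom.hom (s.dinatural (freeModMap A f) (ζ ∘ₗ formLinear k lam X z))
    change _ ≫ _ = f ≫ _ ≫ _
    rw [reassoc_of% h₁]
    refine congrArg (freeUnit A y ≫ ·) (Eq.trans (congrArg (fun ξ => (s.app _ ξ).hom) ?_) h₂)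
    exact LinearMap.ext fun g => congrArg ζ (formLinear_comp g f).symm

/-- The morphism of `A`-modules induced by a cowedge. -/
def moduleDesc {X Z : Mod M A} (s : NakayamaCowedge k X Z) :
    (twistFunctor h h₁ ⋙ liftFunctor hN h₂).obj X ⟶ Z :=
  Mod.Hom.mk' (hN.desc (freeCowedge lam s)) <| by
    -- Linearity of the induced map is checked on the images of the cowedge components under the
    -- left adjoint `A ⊙ -`.
    refine hN.map_hom_ext (m := (Iᘁ : C) ⊙ₗ X.X) (actionAdj M (ᘁA : C) A) fun y ζ => ?_
    have e₁ := map_cowedge_smul hN h h₁ h₂ X y ζ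
    have e₂ : A ⊴ₗ (hN.cowedge ((Iᘁ : C) ⊙ₗ X.X)).app y ζ ≫ A ⊴ₗ hN.desc (freeCowedge lam s) =
        A ⊴ₗ freeUnit A y ≫ A ⊴ₗ (s.app (freeMod A y) (ζ ∘ₗ formLinear k lam X y)).hom := by
      rw [← actionHomRight_comp, hN.fac, ← actionHomRight_comp]
      rfl
    have e₃ := mod_smul_hom (s.app (freeMod A y) (ζ ∘ₗ formLinear k lam X y))
    have e₄ : A ⊴ₗ freeUnit A y ≫ (actMod (freeMod A y)).hom = 𝟙 (A ⊙ₗ y) :=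
      (actionMonad M A).right_unit y
    have e₅ : freeUnit A (A ⊙ₗ y) ≫ (actMod (freeMod A y)).hom = 𝟙 (A ⊙ₗ y) :=
      (isMonadAction_free (actionMonad M A) y).unit
    have e₆ := congrArg Mod.Hom.hom
      (s.dinatural (actMod (freeMod A y)) (ζ ∘ₗ formLinear k lam X y))
    calc _ = (hN.cowedge ((Iᘁ : C) ⊙ₗ X.X)).app (A ⊙ₗ y) (ζ ∘ₗ formLinear k lam X y ∘ₗ
            traceLinear k h X (freeMod A y)) ≫ hN.desc (freeCowedge lam s) :=
          (Category.assoc _ _ _).symm.trans (congrArg (· ≫ _) e₁)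
      _ = freeUnit A (A ⊙ₗ y) ≫ (s.app (freeMod A (A ⊙ₗ y)) ((ζ ∘ₗ formLinear k lam X y ∘ₗ
            traceLinear k h X (freeMod A y)) ∘ₗ formLinear k lam X (A ⊙ₗ y))).hom := hN.fac _ _ _
      _ = freeUnit A (A ⊙ₗ y) ≫ (actMod (freeMod A y)).hom ≫
            (s.app (freeMod A y) (ζ ∘ₗ formLinear k lam X y)).hom := by
          refine congrArg (freeUnit A (A ⊙ₗ y) ≫ ·) (Eq.trans (congrArg (fun ξ =>
            (s.app (freeMod A (A ⊙ₗ y)) ξ).hom) (LinearMap.ext fun g => congrArg ζ ?_)) e₆)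
          exact congrArg (formLinear k lam X y) (traceLinear_formLinear (k := k) h (freeMod A y) g)
      _ = A ⊴ₗ freeUnit A y ≫ (actMod (freeMod A y)).hom ≫
            (s.app (freeMod A y) (ζ ∘ₗ formLinear k lam X y)).hom := by
          -- The units inserted outside and inside `A ⊙ y` are both sections of the multiplication.
          rw [reassoc_of% e₅, reassoc_of% e₄]
      _ = A ⊴ₗ freeUnit A y ≫ A ⊴ₗ (s.app (freeMod A y) (ζ ∘ₗ formLinear k lam X y)).hom ≫
            ModObj.smul (M := A) (X := Z.X) := congrArg (_ ≫ ·) e₃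
      _ = _ := (Category.assoc _ _ _).symm.trans
          ((congrArg (· ≫ _) e₂.symm).trans (Category.assoc _ _ _))

/-- The Nakayama functor of the category of `A`-modules, for an algebra `A` with a Frobenius
trace. -/
def moduleNakayama : NakayamaStructure k (twistFunctor h h₁ ⋙ liftFunctor hN h₂) where
  cowedge := moduleCowedge hN h h₁ h₂
  natural {X X'} f Y ξ := Mod.hom_ext _ _ <| by
    refine (hN.natural _ _ _).trans ?_
    rw [moduleCowedge_hom]
    refine congrArg _ (LinearMap.ext fun g => congrArg ξ ?_)
    exact (comp_traceLinear h g f).symm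
  desc := moduleDesc hN h h₁ h₂
  fac {X Z} s Y ξ := Mod.hom_ext _ _ <| by
    refine (hN.fac _ _ _).trans ?_
    -- Each module is a quotient of a free one by `actMod Y`. Dinaturality along it recovers `s` at
    -- `Y` from `s` at the free module, since the unit splits the action.
    have e := congrArg Mod.Hom.hom (s.dinatural (actMod Y) ξ)
    calc _ = freeUnit A Y.X ≫ (s.app (freeMod A Y.X) (ξ ∘ₗ Linear.rightComp k X (actMod Y))).hom :=
          congrArg (fun ξ => freeUnit A Y.X ≫ (s.app (freeMod A Y.X) ξ).hom)
            (LinearMap.ext fun g => congrArg ξ (traceLinear_formLinear h Y g))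
      _ = freeUnit A Y.X ≫ ModObj.smul (M := A) (X := Y.X) ≫ (s.app Y ξ).hom :=
          congrArg (freeUnit A Y.X ≫ ·) e
      _ = _ := by rw [← Category.assoc, freeUnit_smul, Category.id_comp]
  uniq {X Z} s g hg := Mod.hom_ext _ _ <| by
    refine hN.uniq (m := (Iᘁ : C) ⊙ₗ X.X) _ _ fun y ζ => ?_
    refine Eq.trans ?_ (congrArg (fun f => freeUnit A y ≫ Mod.Hom.hom f)
      (hg (freeMod A y) (ζ ∘ₗ formLinear k lam X y)))
    refine Eq.trans (congrArg (· ≫ g.hom) (?_ : _ = freeUnit A y ≫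
      (hN.cowedge ((Iᘁ : C) ⊙ₗ X.X)).app (A ⊙ₗ y) ((ζ ∘ₗ formLinear k lam X y) ∘ₗ
        traceLinear k h X (freeMod A y)))) (Category.assoc _ _ _)
    -- Every component of the cowedge of `N` comes from the module cowedge at a free module: form
    -- after trace of `f ≫ η` is `f`, so `ζ` is recovered.
    rw [← (hN.cowedge _).dinatural]
    refine congrArg _ (LinearMap.ext fun f => congrArg ζ ?_)
    exact (formLinear_traceLinear_unit h f).symm

end ModuleNakayama

/-! ### The Nakayama functor of a finite abelian category -/

section FGModules

/-! ### Elements of a module as morphisms from the regular module. -/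

section Points

variable {R : Type w} [Ring R]

theorem fgModule_hom_ext {x y : FGModuleCat.{w} R} {f g : x ⟶ y}
    (h : ∀ v, f.hom.hom v = g.hom.hom v) : f = g :=
  FGModuleCat.hom_ext (LinearMap.ext h)

variable (R) in
/-- The regular module. -/
abbrev regularMod : FGModuleCat.{w} R := FGModuleCat.of R R

/-- The morphism from the regular module corresponding to an element. -/
def pointMap {x : FGModuleCat.{w} R} (v : x) : regularMod R ⟶ x :=
  ObjectProperty.homMk (ModuleCat.ofHom (LinearMap.toSpanSingleton R x v))

theorem pointMap_comp {x y : FGModuleCat.{w} R} (v : x) (f : x ⟶ y) :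
    pointMap v ≫ f = pointMap (f.hom.hom v) :=
  fgModule_hom_ext fun r => f.hom.hom.map_smul r v

theorem pointMap_comp_pointMap {x : FGModuleCat.{w} R} (r : R) (v : x) :
    pointMap (x := regularMod R) r ≫ pointMap v = pointMap (r • v) :=
  pointMap_comp _ _

theorem pointMap_one : pointMap (x := regularMod R) (1 : R) = 𝟙 _ :=
  fgModule_hom_ext fun r => mul_one (r : R)

theorem pointMap_add {x : FGModuleCat.{w} R} (v v' : x) :
    pointMap (v + v') = pointMap v + pointMap v' :=
  fgModule_hom_ext fun r => smul_add r v v'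

theorem pointMap_zero {x : FGModuleCat.{w} R} : pointMap (0 : x) = 0 :=
  fgModule_hom_ext fun r => smul_zero r

end Points

variable (k : Type w) [Field k] {R : Type w} [Ring R] [Algebra k R]

/-- Scalars are central in `R`, so right multiplication by one is scalar multiplication. This makes
the `k`- and `R`-structures on `HomDual` compatible. -/
theorem comp_pointMap_algebraMap {m : FGModuleCat.{w} R} (f : m ⟶ regularMod R) (c : k) :
    f ≫ pointMap (x := regularMod R) (algebraMap k R c) = c • f :=
  fgModule_hom_ext fun v => (Algebra.commutes c (f.hom.hom v : R)).symm

/-- The dual of the space of morphisms to the regular module. -/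
def HomDual (m : FGModuleCat.{w} R) : Type w := Module.Dual k (m ⟶ regularMod R)

instance (m : FGModuleCat.{w} R) : AddCommGroup (HomDual k m) :=
  inferInstanceAs (AddCommGroup (Module.Dual k (m ⟶ regularMod R)))

instance (m : FGModuleCat.{w} R) : Module k (HomDual k m) :=
  inferInstanceAs (Module k (Module.Dual k (m ⟶ regularMod R)))

/-- A linear form on the space of morphisms to the regular module as an element of `HomDual`. -/
def HomDual.equiv (m : FGModuleCat.{w} R) : HomDual k m ≃ₗ[k] Module.Dual k (m ⟶ regularMod R) :=
  LinearEquiv.refl k _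

/-- `pointMap r` is right multiplication by `r`; it makes `Hom(m, R)` a right module, so the dual is
a left module. -/
instance (m : FGModuleCat.{w} R) : SMul R (HomDual k m) where
  smul r ξ := (HomDual.equiv k m).symm
    (HomDual.equiv k m ξ ∘ₗ Linear.rightComp k m (pointMap (x := regularMod R) r))

variable {k} in
@[ext]
theorem HomDual.ext {m : FGModuleCat.{w} R} {ξ ξ' : HomDual k m}
    (h : ∀ f, HomDual.equiv k m ξ f = HomDual.equiv k m ξ' f) : ξ = ξ' :=
  (HomDual.equiv k m).injective (LinearMap.ext h)

theorem HomDual.smul_apply {m : FGModuleCat.{w} R} (r : R) (ξ : HomDual k m)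
    (f : m ⟶ regularMod R) : HomDual.equiv k m (r • ξ) f =
      HomDual.equiv k m ξ (f ≫ pointMap (x := regularMod R) r) := rfl

instance (m : FGModuleCat.{w} R) : Module R (HomDual k m) where
  one_smul ξ := by ext f; rw [HomDual.smul_apply, pointMap_one, Category.comp_id]
  mul_smul r s ξ := by
    ext f
    rw [HomDual.smul_apply, HomDual.smul_apply, HomDual.smul_apply, Category.assoc,
      pointMap_comp_pointMap, smul_eq_mul]
  smul_zero r := rfl
  smul_add r ξ ξ' := rfl
  add_smul r s ξ := by
    ext f
    rw [map_add, LinearMap.add_apply, HomDual.smul_apply, HomDual.smul_apply, HomDual.smul_apply,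
      pointMap_add, Preadditive.comp_add, map_add]
  zero_smul ξ := by
    ext f
    rw [HomDual.smul_apply, pointMap_zero, Limits.comp_zero, map_zero, map_zero,
      LinearMap.zero_apply]

instance (m : FGModuleCat.{w} R) : IsScalarTower k R (HomDual k m) :=
  .of_algebraMap_smul fun c ξ => by
    ext f
    rw [HomDual.smul_apply, comp_pointMap_algebraMap, map_smul, map_smul, LinearMap.smul_apply]

variable [Module.Finite k R]

/-- A morphism is determined by its values on finitely many generators, so the space embeds in a
power of `R`. -/
instance (m : FGModuleCat.{w} R) : Module.Finite k (m ⟶ regularMod R) := by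
  obtain ⟨n, s, hs⟩ := Module.Finite.exists_fin (R := R) (M := m)
  let F : (m ⟶ regularMod R) →ₗ[k] (Fin n → R) :=
    { toFun f i := f.hom.hom (s i)
      map_add' _ _ := rfl
      map_smul' c f := funext fun i => (Algebra.smul_def c (f.hom.hom (s i) : R)).symm }
  refine Module.Finite.of_injective F fun f g h => FGModuleCat.hom_ext ?_
  exact LinearMap.ext_on_range hs (congrFun h)

instance (m : FGModuleCat.{w} R) : Module.Finite k (HomDual k m) :=
  inferInstanceAs (Module.Finite k (Module.Dual k (m ⟶ regularMod R)))

instance (m : FGModuleCat.{w} R) : Module.Finite R (HomDual k m) :=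
  Module.Finite.of_restrictScalars_finite k R _

variable (R) in
/-- The functor `m ↦ Hom(m, R)^*`. -/
def fgNakayama : FGModuleCat.{w} R ⥤ FGModuleCat.{w} R where
  obj m := FGModuleCat.of R (HomDual k m)
  map {m m'} f := FGModuleCat.ofHom
    { toFun ξ := (HomDual.equiv k m').symm (HomDual.equiv k m ξ ∘ₗ Linear.leftComp k _ f)
      map_add' _ _ := rfl
      map_smul' r ξ := by
        ext g
        exact congrArg (HomDual.equiv k m ξ) (Category.assoc f g (pointMap (x := regularMod R) r)) }
  map_id m := fgModule_hom_ext fun ξ => HomDual.ext fun g =>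
    congrArg (HomDual.equiv k m ξ) (Category.id_comp g)
  map_comp {m _ _} f f' := fgModule_hom_ext fun ξ => HomDual.ext fun g =>
    congrArg (HomDual.equiv k m ξ) (Category.assoc f f' g)

variable {k} in
/-- The morphism `Hom(m, R)^* ⟶ z` induced by a cowedge. -/
def fgNakayamaDesc {m z : FGModuleCat.{w} R} (s : NakayamaCowedge k m z) :
    (fgNakayama k R).obj m ⟶ z :=
  ObjectProperty.homMk <| ModuleCat.ofHom
    { toFun (ξ : HomDual k m) := (s.app (regularMod R) (HomDual.equiv k m ξ)).hom.hom (1 : R)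
      map_add' ξ ξ' := by rw [map_add, map_add]; rfl
      map_smul' r (ξ : HomDual k m) := by
        -- Dinaturality along right multiplication by `r`, evaluated at `1`, moves `r` out of the
        -- linear form.
        have h := congrArg (fun f => f.hom.hom (1 : R))
          (s.dinatural (pointMap (x := regularMod R) r) (HomDual.equiv k m ξ))
        refine h.trans ?_
        change (s.app (regularMod R) (HomDual.equiv k m ξ)).hom.hom ((1 : R) • r : R) = _
        rw [one_smul, RingHom.id_apply, ← map_smul]
        exact congrArg _ (mul_one r).symm }

variable (R) in
/-- The functor `m ↦ Hom(m, R)^*` is the Nakayama functor. -/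
def fgNakayamaStructure : NakayamaStructure k (fgNakayama k R) where
  cowedge m :=
    { app x :=
        { toFun ξ := ObjectProperty.homMk <| ModuleCat.ofHom
            { toFun v := (HomDual.equiv k m).symm (ξ ∘ₗ Linear.rightComp k m (pointMap v))
              map_add' v v' := by
                ext g
                change ξ (g ≫ pointMap (v + v')) = ξ (g ≫ pointMap v) + ξ (g ≫ pointMap v')
                rw [pointMap_add, Preadditive.comp_add, map_add]
              map_smul' r v := by
                ext g
                change ξ (g ≫ pointMap (r • v)) = ξ ((g ≫ pointMap (x := regularMod R) r) ≫ _)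
                rw [Category.assoc, pointMap_comp_pointMap] }
          map_add' _ _ := rfl
          map_smul' c ξ := fgModule_hom_ext fun v => (algebraMap_smul R c
            ((HomDual.equiv k m).symm (ξ ∘ₗ Linear.rightComp k m (pointMap v)))).symm }
      dinatural {x y} f ξ := fgModule_hom_ext fun v => HomDual.ext fun g => by
        change ξ ((g ≫ pointMap v) ≫ f) = ξ (g ≫ pointMap (f.hom.hom v))
        rw [Category.assoc, pointMap_comp] }
  natural {m m'} f x ξ := fgModule_hom_ext fun v => HomDual.ext fun g =>
    congrArg ξ (Category.assoc f g (pointMap v))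
  desc s := fgNakayamaDesc s
  fac {m z} s x ξ := fgModule_hom_ext fun v => by
    -- A cowedge is determined by its component at `R`, through dinaturality along the map `R ⟶ x`
    -- that sends `1` to `v`.
    have h := congrArg (fun f => f.hom.hom (1 : R)) (s.dinatural (pointMap v) ξ)
    refine h.trans ?_
    change (s.app x ξ).hom.hom ((1 : R) • v) = _
    rw [one_smul]
  uniq {m z} s g hg := fgModule_hom_ext fun ξ => by
    -- At `x = R` the universal cowedge of `ξ` takes `1` to `ξ`, so the values of `g` are forced.
    have h := congrArg (fun f => f.hom.hom (1 : R)) (hg (regularMod R) (HomDual.equiv k m ξ))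
    refine Eq.trans ?_ h
    refine congrArg g.hom.hom (HomDual.ext fun f => ?_)
    change _ = HomDual.equiv k m ξ (f ≫ pointMap (x := regularMod R) (1 : R))
    rw [pointMap_one, Category.comp_id]

end FGModules

/-! ### Transport of Nakayama functors along linear equivalences. -/

section Transport

variable {k : Type w} [Field k] {M : Type u} [Category.{v} M] [Preadditive M] [Linear k M]
  {M' : Type u₁} [Category.{v₁} M'] [Preadditive M'] [Linear k M'] (e : M ≌ M')
  [e.functor.Additive] [e.functor.Linear k]

variable (k) in
/-- The inverse of the action of an equivalence on morphisms. -/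
def equivPreimage (m x : M) : (e.functor.obj m ⟶ e.functor.obj x) →ₗ[k] (m ⟶ x) where
  toFun f := e.functor.preimage f
  map_add' f g := e.functor.map_injective (by simp)
  map_smul' r f := e.functor.map_injective (by simp)

variable (k) in
/-- The hom-set bijection of the adjunction underlying an equivalence. -/
def equivTranspose (m : M) (y : M') : (m ⟶ e.inverse.obj y) →ₗ[k] (e.functor.obj m ⟶ y) where
  toFun f := e.functor.map f ≫ e.counit.app y
  map_add' := by simp
  map_smul' := by simp

/-- The cowedge on an equivalent category corresponding to a cowedge. -/
def transportCowedge {m z : M} (s : NakayamaCowedge k m z) :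
    NakayamaCowedge k (e.functor.obj m) (e.functor.obj z) where
  app y :=
    { toFun ξ := e.counitInv.app y ≫ e.functor.map (s.app (e.inverse.obj y)
        (ξ ∘ₗ equivTranspose k e m y))
      map_add' ξ ξ' := by simp [LinearMap.add_comp]
      map_smul' r ξ := by simp [LinearMap.smul_comp] }
  dinatural {x y} f ξ := by
    have h : (ξ ∘ₗ Linear.rightComp k (e.functor.obj m) f) ∘ₗ equivTranspose k e m x =
        (ξ ∘ₗ equivTranspose k e m y) ∘ₗ Linear.rightComp k m (e.inverse.map f) := by
      ext g
      simp [equivTranspose]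
    simp only [LinearMap.coe_mk, AddHom.coe_mk]
    rw [h, s.dinatural]
    simp

theorem transportCowedge_app {m z : M} (s : NakayamaCowedge k m z) (y : M')
    (ξ : Module.Dual k (e.functor.obj m ⟶ y)) :
    (transportCowedge e s).app y ξ =
      e.counitInv.app y ≫ e.functor.map (s.app (e.inverse.obj y)
        (ξ ∘ₗ equivTranspose k e m y)) := rfl

variable [e.inverse.Additive] [e.inverse.Linear k]

/-- Transport of a Nakayama functor along an equivalence. -/
def transportNakayama {N : M' ⥤ M'} (hN : NakayamaStructure k N) :
    NakayamaStructure k (e.functor ⋙ N ⋙ e.inverse) where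
  cowedge m :=
    { app x :=
        { toFun ξ := e.unit.app x ≫ e.inverse.map
            ((hN.cowedge (e.functor.obj m)).app (e.functor.obj x) (ξ ∘ₗ equivPreimage k e m x))
          map_add' ξ ξ' := by simp [LinearMap.add_comp]
          map_smul' r ξ := by simp [LinearMap.smul_comp] }
      dinatural {x y} f ξ := by
        have h : (ξ ∘ₗ Linear.rightComp k m f) ∘ₗ equivPreimage k e m x =
            (ξ ∘ₗ equivPreimage k e m y) ∘ₗ
              Linear.rightComp k (e.functor.obj m) (e.functor.map f) := by
          ext g
          refine congrArg ξ (e.functor.map_injective ?_)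
          simp [equivPreimage]
        simp only [LinearMap.coe_mk, AddHom.coe_mk]
        rw [h, (hN.cowedge _).dinatural]
        simp }
  natural {m m'} f x ξ := by
    have h : (ξ ∘ₗ Linear.leftComp k x f) ∘ₗ equivPreimage k e m' x =
        (ξ ∘ₗ equivPreimage k e m x) ∘ₗ
          Linear.leftComp k (e.functor.obj x) (e.functor.map f) := by
      ext g
      refine congrArg ξ (e.functor.map_injective ?_)
      simp [equivPreimage]
    simp only [LinearMap.coe_mk, AddHom.coe_mk, Functor.comp_map, Category.assoc]
    rw [h, ← hN.natural, ← e.inverse.map_comp]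
  desc {m z} s := e.inverse.map (hN.desc (transportCowedge e s)) ≫ e.unitInv.app z
  fac {m z} s x ξ := by
    have h : (ξ ∘ₗ equivPreimage k e m x) ∘ₗ equivTranspose k e m (e.functor.obj x) =
        ξ ∘ₗ Linear.rightComp k m (e.unitInv.app x) := by
      ext g
      refine congrArg ξ (e.functor.map_injective ?_)
      simp [equivPreimage, equivTranspose, Equivalence.counit_app_functor]
    -- The round trip through the equivalence leaves `e.unitInv` in the linear form; dinaturality
    -- along `e.unit` cancels it.
    have h' : s.app x ((ξ ∘ₗ Linear.rightComp k m (e.unitInv.app x)) ∘ₗ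
        Linear.rightComp k m (e.unit.app x)) = e.unit.app x ≫
          s.app (e.inverse.obj (e.functor.obj x)) (ξ ∘ₗ Linear.rightComp k m (e.unitInv.app x)) :=
      s.dinatural (e.unit.app x) _
    have h'' : (ξ ∘ₗ Linear.rightComp k m (e.unitInv.app x)) ∘ₗ
        Linear.rightComp k m (e.unit.app x) = ξ := by
      ext g
      simp
    rw [h''] at h'
    simp only [LinearMap.coe_mk, AddHom.coe_mk, Category.assoc]
    rw [← e.inverse.map_comp_assoc, hN.fac, transportCowedge_app, h, h']
    simp
  uniq {m z} s g hg := by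
    -- The functor `e.functor` carries the question to the other category, where uniqueness for `N`
    -- applies; `g` is recovered by applying `e.inverse`.
    have key : e.counitInv.app _ ≫ e.functor.map g = hN.desc (transportCowedge e s) := by
      refine hN.uniq _ _ fun y ξ => ?_
      have h : (ξ ∘ₗ equivTranspose k e m y) ∘ₗ equivPreimage k e m (e.inverse.obj y) =
          ξ ∘ₗ Linear.rightComp k (e.functor.obj m) (e.counit.app y) := by
        ext g
        simp [equivPreimage, equivTranspose]
      rw [transportCowedge_app, ← hg]
      simp only [LinearMap.coe_mk, AddHom.coe_mk, Category.assoc]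
      rw [h, (hN.cowedge _).dinatural]
      simp
    rw [← key]
    simp

end Transport

theorem exists_nakayamaStructure (k : Type w) [Field k] (M : Type u) [Category.{v} M]
    [Preadditive M] [Linear k M] [IsFiniteAbelian k M] :
    ∃ N : M ⥤ M, Nonempty (NakayamaStructure k N) := by
  obtain ⟨R, _, _, _, e, _, _⟩ := IsFiniteAbelian.exists_equivalence (k := k) (M := M)
  have := e.inverse_additive
  have : e.inverse.Linear k := inferInstance
  exact ⟨_, ⟨transportNakayama e (fgNakayamaStructure k R)⟩⟩

end FrobTrace

end

theorem mainTheorem4 {k : Type w} [Field k]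
    {C : Type u₁} [Category.{v₁} C] [Preadditive C] [Linear k C] [MonoidalCategory C]
    [RigidCategory C] [IsFiniteMultiTensor k C]
    {M : Type u₂} [Category.{v₂} M] [Preadditive M] [Linear k M] [MonoidalLeftAction C M]
    [IsFiniteModuleCategory k C M]
    (I : C) (hI : IsInvertibleObject I) (A : C) [MonObj A] (lam : A ⟶ I)
    (hlam : IsFrobeniusTrace lam) :
    (∃ N : M ⥤ M, Nonempty (NakayamaStructure k N)) ∧
    ∀ (N : M ⥤ M) (hN : NakayamaStructure k N),
      ∃ (h₁ : ∀ X : Mod M A, IsModuleAction ((Aᘁ : C)ᘁ : C) (twistedAction hlam X))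
        (h₂ : ∀ X : Mod M ((Aᘁ : C)ᘁ : C), IsModuleAction A (liftedAction hN X)),
        Nonempty (NakayamaStructure k (twistFunctor hlam h₁ ⋙ liftFunctor hN h₂)) :=
  ⟨exists_nakayamaStructure k M, fun _ hN =>
    ⟨isModuleAction_twistedAction hlam, isModuleAction_liftedAction hN,
      ⟨moduleNakayama hN hlam _ _⟩⟩⟩
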